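/- Let $n\ge 2$ be an integer, put $$\gamma(p,n)=2+(n+1)p-(n-1)p^2,\qquad p_0(n)=\frac{n+1+\sqrt{n^2+10n-7}}{2(n-1)},$$ where $p_0(n)$ is the positive root of $\gamma(\cdot,n)=0$, and let $1<p<p_0(n)$. Let $f\in H^1(\mathbb R^n)$ and $g\in L^2(\mathbb R^n)$ be real-valued and non-negative, both with compact support, with $g$ not vanishing identically (all in the almost everywhere sense), and let $R\in\mathbb R$. For $\varepsilon>0$ consider the initial value problem $$u_{tt}-\Delta u=|u|^p,\qquad u(x,0)=\varepsilon f(x),\quad u_t(x,0)=\varepsilon g(x).\qquad(*)$$ By a solution of $(*)$ on $[0,T)$, $T>0$, we mean a function $u$ with $(u,u_t)\in C([0,T),H^1(\mathbb R^n)\times L^2(\mathbb R^n))$ ($u_t$ being the derivative of $u$ as an $L^2(\mathbb R^n)$-valued function of $t$), which attains the initial data, satisfies $$\operatorname{supp}(u,u_t)\subset\{(x,t)\in\mathbb R^n\times[0,\infty): |x|\le t+R\},$$ and solves the equation in the sense of distributions on $\mathbb R^n\times(0,T)$: $u$ and $|u|^p$ are locally integrable there, and $\iint u\,(\varphi_{tt}-\Delta\varphi)\,dx\,dt=\iint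 |u|^p\varphi\,dx\,dt$ for all $\varphi\in C_c^\infty(\mathbb R^n\times(0,T))$. Let the lifespan $T(\varepsilon)\in[0,\infty]$ be the supremum of all $T>0$ such that $(*)$ has a solution on $[0,T)$ (and $0$ if there is none). Then there exist constants $\varepsilon_0=\varepsilon_0(f,g,n,p,R)>0$ and $C>0$, with $C$ independent of $\varepsilon$, such that $$T(\varepsilon)\le C\,\varepsilon^{-2p(p-1)/\gamma(p,n)}\qquad\text{for all }0<\varepsilon\le\varepsilon_0 .$$ -/

import Mathlib

open MeasureTheory Set Filter Topology

open scoped ENNReal ContDiff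

namespace SemilinearWave

/-- The quadratic `γ(p, n) = 2 + (n + 1) p - (n - 1) p²`. -/
noncomputable def gammaExponent (p : ℝ) (n : ℕ) : ℝ :=
  2 + ((n : ℝ) + 1) * p - ((n : ℝ) - 1) * p ^ 2

/-- Strauss' exponent `p₀(n)`, the positive root of `γ(·, n)`, for `n ≥ 2`. -/
noncomputable def straussExponent (n : ℕ) : ℝ :=
  ((n : ℝ) + 1 + Real.sqrt ((n : ℝ) ^ 2 + 10 * (n : ℝ) - 7)) / (2 * ((n : ℝ) - 1))

/-- `w` is the weak (distributional) gradient of `h` on `ℝⁿ`: for all test functions `φ`,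
`∫ h ∇φ = - ∫ φ w`. -/
def IsWeakGradient {n : ℕ} (h : EuclideanSpace ℝ (Fin n) → ℝ)
    (w : EuclideanSpace ℝ (Fin n) → EuclideanSpace ℝ (Fin n)) : Prop :=
  LocallyIntegrable h ∧ LocallyIntegrable w ∧
    ∀ φ : EuclideanSpace ℝ (Fin n) → ℝ, ContDiff ℝ ∞ φ → HasCompactSupport φ →
      ∫ x, h x • gradient φ x = - ∫ x, φ x • w x

/-- Membership in the Sobolev space `H¹(ℝⁿ)`. -/
def MemH1 {n : ℕ} (h : EuclideanSpace ℝ (Fin n) → ℝ) : Prop :=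
  MemLp h 2 ∧ ∃ w : EuclideanSpace ℝ (Fin n) → EuclideanSpace ℝ (Fin n),
    IsWeakGradient h w ∧ MemLp w 2

/-- `t ↦ h t` is a continuous curve `[0, T) → L²(ℝⁿ; F)`. -/
def ContinuousL2 {n : ℕ} {F : Type} [NormedAddCommGroup F] (T : ℝ)
    (h : ℝ → EuclideanSpace ℝ (Fin n) → F) : Prop :=
  (∀ t ∈ Ico 0 T, MemLp (h t) 2) ∧
    ∀ t ∈ Ico 0 T, Tendsto (fun s => eLpNorm (h s - h t) 2) (𝓝[Ico 0 T] t) (𝓝 0)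

/-- `t ↦ h t` is a continuous curve `[0, T) → H¹(ℝⁿ)`: it is continuous into `L²`, and so is
the curve of its weak spatial gradients. -/
def ContinuousH1 {n : ℕ} (T : ℝ) (h : ℝ → EuclideanSpace ℝ (Fin n) → ℝ) : Prop :=
  ContinuousL2 T h ∧
    ∃ w : ℝ → EuclideanSpace ℝ (Fin n) → EuclideanSpace ℝ (Fin n),
      (∀ t ∈ Ico 0 T, IsWeakGradient (h t) (w t)) ∧ ContinuousL2 T w

/-- `ut` is the time derivative of the curve `u` on `[0, T)`: the difference quotients converge
in `L²(ℝⁿ)` (one-sided at `t = 0`). -/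
def IsTimeDerivative {n : ℕ} (T : ℝ) (u ut : ℝ → EuclideanSpace ℝ (Fin n) → ℝ) : Prop :=
  ∀ t ∈ Ico 0 T,
    Tendsto (fun s => eLpNorm (fun x => (u s x - u t x) / (s - t) - ut t x) 2)
      (𝓝[Ico 0 T \ {t}] t) (𝓝 0)

/-- `u_tt - Δu = |u|^p` in the sense of distributions on `(0, T) × ℝⁿ`. Here `u` and `|u|^p`
are locally integrable on `(0, T) × ℝⁿ`, so that both are distributions there. -/
def SolvesWeakly {n : ℕ} (p T : ℝ) (u : ℝ → EuclideanSpace ℝ (Fin n) → ℝ) : Prop :=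
  LocallyIntegrableOn (fun z : ℝ × EuclideanSpace ℝ (Fin n) => u z.1 z.2) (Ioo 0 T ×ˢ univ) ∧
  LocallyIntegrableOn (fun z : ℝ × EuclideanSpace ℝ (Fin n) => |u z.1 z.2| ^ p)
    (Ioo 0 T ×ˢ univ) ∧
  ∀ φ : ℝ × EuclideanSpace ℝ (Fin n) → ℝ, ContDiff ℝ ∞ φ → HasCompactSupport φ →
    tsupport φ ⊆ Ioo 0 T ×ˢ univ →
      ∫ z in Ioo 0 T ×ˢ univ, u z.1 z.2 *
          (iteratedDeriv 2 (fun s => φ (s, z.2)) z.1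
            - Laplacian.laplacian (fun y => φ (z.1, y)) z.2)
        = ∫ z in Ioo 0 T ×ˢ univ, |u z.1 z.2| ^ p * φ z

/-- `u`, with time derivative `ut`, is a solution on `[0, T)` of the initial value problem
`u_tt - Δu = |u|^p`, `u(0) = ε f`, `u_t(0) = ε g`, with
`(u, u_t) ∈ C([0, T), H¹(ℝⁿ) × L²(ℝⁿ))` and `supp (u, u_t) ⊆ {|x| ≤ t + R}`. -/
structure IsSolution {n : ℕ} (p : ℝ) (f g : EuclideanSpace ℝ (Fin n) → ℝ) (R ε T : ℝ)
    (u ut : ℝ → EuclideanSpace ℝ (Fin n) → ℝ) : Prop where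
  continuous_u : ContinuousH1 T u
  continuous_ut : ContinuousL2 T ut
  time_derivative : IsTimeDerivative T u ut
  initial_u : ∀ᵐ x, u 0 x = ε * f x
  initial_ut : ∀ᵐ x, ut 0 x = ε * g x
  equation : SolvesWeakly p T u
  support_u : ∀ t ∈ Ico 0 T, ∀ᵐ x, t + R < ‖x‖ → u t x = 0
  support_ut : ∀ t ∈ Ico 0 T, ∀ᵐ x, t + R < ‖x‖ → ut t x = 0

/-- The lifespan `T(ε) ∈ [0, ∞]`: the supremum of all `T > 0` such that the initial value problem
has a solution on `[0, T)`. -/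
noncomputable def lifespan {n : ℕ} (p : ℝ) (f g : EuclideanSpace ℝ (Fin n) → ℝ) (R ε : ℝ) :
    ℝ≥0∞ :=
  ⨆ T ∈ {T : ℝ | 0 < T ∧ ∃ u ut : ℝ → EuclideanSpace ℝ (Fin n) → ℝ,
    IsSolution p f g R ε T u ut}, ENNReal.ofReal T

end SemilinearWave

/-! Test the equation against plane waves `exp (⟪ξ, x⟫ - ‖ξ‖ t)`, which solve the free wave
equation. With `U = ∫ u exp ⟪ξ, x⟫` and `V = U'`, the quantity `P = exp (-‖ξ‖ t) (V + ‖ξ‖ U)`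
satisfies `P' = exp (-‖ξ‖ t) ∫ |u|^p exp ⟪ξ, x⟫ ≥ 0` weakly in time
(`IsSolution.integral_deriv_mul_planeMomentum`). The rest of the argument uses only `‖ξ‖ = 1` and `ξ
= 0`.

For `‖ξ‖ = 1`, monotonicity of `P` gives `exp (-t) U ≥ c ε` for `t ≥ 1`, uniformly in the direction
(`IsSolution.expMean_ge`). Averaging over directions replaces the exponential by `sphereExp`, of
size at most `exp ‖x‖ (1 + ‖x‖) ^ (-(n - 1) / 2)`. Hölder's inequality on the ball of radius `t + R`
then yields `∫ |u|^p ≥ c ε^p (1 + t) ^ ((n - 1) (1 - p / 2))` (`exists_integral_rpow_ge_data`).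

For `ξ = 0`, `U'' = ∫ |u|^p` in integrated form. Besides the bound just found, Hölder against the
constant 1 gives `U'' ≥ c (t + R) ^ (-n (p - 1)) U^p` (`exists_integral_rpow_ge_mean`). The first
inequality makes `U` large; the second then forces blow-up (`exists_kato_constant`). Comparing
powers of `ε` and time gives `ε ^ (p (p - 1)) T₀ ^ (γ / 2) ≤ K` whenever `1 ≤ T₀` and `4 T₀ ≤ T`.
Since `γ > 0` below the Strauss exponent, this bounds the lifespan. -/

namespace SemilinearWave

/-! ### Product test functions in the weak equation -/

section WeakForm

variable {n : ℕ}

local notation "𝔼" => EuclideanSpace ℝ (Fin n)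

theorem continuous_laplacian {θ : 𝔼 → ℝ} (hθ : ContDiff ℝ ∞ θ) :
    Continuous (Laplacian.laplacian θ) := by
  rw [InnerProductSpace.laplacian_eq_iteratedFDeriv_stdOrthonormalBasis]
  refine continuous_finsetSum _ fun i _ => ?_
  have h : Continuous (iteratedFDeriv ℝ 2 θ) :=
    hθ.continuous_iteratedFDeriv (WithTop.coe_le_coe.2 le_top)
  exact (ContinuousMultilinearMap.apply ℝ (fun _ : Fin 2 => 𝔼) ℝ _).continuous.comp h

theorem laplacian_exp_inner (ξ x : 𝔼) :
    Laplacian.laplacian (fun y : 𝔼 => Real.exp (inner ℝ ξ y)) x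
      = ‖ξ‖ ^ 2 * Real.exp (inner ℝ ξ x) := by
  have h1 : ∀ y : 𝔼, HasFDerivAt (fun y : 𝔼 => Real.exp (inner ℝ ξ y))
      (Real.exp (inner ℝ ξ y) • innerSL ℝ ξ) y := fun y =>
    ((innerSL ℝ ξ).hasFDerivAt (x := y)).exp
  have h2 : fderiv ℝ (fun y : 𝔼 => Real.exp (inner ℝ ξ y))
      = fun y => Real.exp (inner ℝ ξ y) • innerSL ℝ ξ := funext fun y => (h1 y).fderiv
  rw [InnerProductSpace.laplacian_eq_iteratedFDeriv_stdOrthonormalBasis]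
  have h3 : ∀ v : 𝔼, iteratedFDeriv ℝ 2 (fun y : 𝔼 => Real.exp (inner ℝ ξ y)) x ![v, v]
      = Real.exp (inner ℝ ξ x) * (inner ℝ ξ v) ^ 2 := by
    intro v
    rw [iteratedFDeriv_two_apply, h2, ((h1 x).smul_const (innerSL ℝ ξ)).fderiv]
    simp
    ring
  simp only [h3, ← Finset.mul_sum]
  rw [mul_comm, ← (stdOrthonormalBasis ℝ 𝔼).sum_sq_norm_inner_left ξ]
  simp

/-- Testing the equation against a tensor product `ζ(t) θ(x)`. -/
theorem SolvesWeakly.tensor {p T : ℝ} {u : ℝ → 𝔼 → ℝ} (hu : SolvesWeakly p T u) {ζ : ℝ → ℝ}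
    (hζ : ContDiff ℝ ∞ ζ) {c d : ℝ} (hc : 0 < c) (hd : d < T) (hζ0 : ∀ t ∉ Icc c d, ζ t = 0)
    {θ : 𝔼 → ℝ} (hθ : ContDiff ℝ ∞ θ) (hθc : HasCompactSupport θ) :
    IntegrableOn (fun z : ℝ × 𝔼 => |u z.1 z.2| ^ p * (ζ z.1 * θ z.2)) (Ioo 0 T ×ˢ univ) ∧
    ∫ t in Ioo 0 T, ∫ x, u t x * (iteratedDeriv 2 ζ t * θ x - ζ t * Laplacian.laplacian θ x)
      = ∫ t in Ioo 0 T, ∫ x, |u t x| ^ p * (ζ t * θ x) := by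
  obtain ⟨h1, h2, h3⟩ := hu
  have hζs : tsupport ζ ⊆ Icc c d :=
    closure_minimal (fun t ht => by_contra fun h => ht (hζ0 t h)) isClosed_Icc
  set K : Set (ℝ × 𝔼) := Icc c d ×ˢ tsupport θ with hK
  have hKc : IsCompact K := isCompact_Icc.prod hθc
  have hKs : K ⊆ Ioo 0 T ×ˢ univ := fun z hz =>
    ⟨⟨hc.trans_le hz.1.1, hz.1.2.trans_lt hd⟩, mem_univ _⟩
  have hφ : ContDiff ℝ ∞ (fun z : ℝ × 𝔼 => ζ z.1 * θ z.2) :=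
    (hζ.comp contDiff_fst).mul (hθ.comp contDiff_snd)
  have hsub : Function.support (fun z : ℝ × 𝔼 => ζ z.1 * θ z.2) ⊆ K := by
    intro z hz
    have hz' : ζ z.1 ≠ 0 ∧ θ z.2 ≠ 0 := by simpa using hz
    exact ⟨hζs (subset_tsupport _ hz'.1), subset_tsupport _ hz'.2⟩
  have hts : tsupport (fun z : ℝ × 𝔼 => ζ z.1 * θ z.2) ⊆ K :=
    closure_minimal hsub hKc.isClosed
  have hcs : HasCompactSupport (fun z : ℝ × 𝔼 => ζ z.1 * θ z.2) :=
    HasCompactSupport.of_support_subset_isCompact hKc hsub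
  have key := h3 _ hφ hcs (hts.trans hKs)
  have hmeas : MeasurableSet (Ioo (0 : ℝ) T ×ˢ (univ : Set 𝔼)) :=
    measurableSet_Ioo.prod MeasurableSet.univ
  have hloc : ∀ (v Ψ : ℝ × 𝔼 → ℝ), LocallyIntegrableOn v (Ioo 0 T ×ˢ univ) → Continuous Ψ →
      (∀ z ∉ K, Ψ z = 0) → IntegrableOn (fun z => v z * Ψ z) (Ioo 0 T ×ˢ univ) := by
    intro v Ψ hv hΨ hΨ0
    refine IntegrableOn.of_forall_sdiff_eq_zero
      ((hv.integrableOn_compact_subset hKs hKc).mul_continuousOn hΨ.continuousOn hKc) hmeas ?_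
    intro z hz
    simp [hΨ0 z hz.2]
  have hderiv : ∀ (t : ℝ) (x : 𝔼), iteratedDeriv 2 (fun s => ζ s * θ x) t
      = iteratedDeriv 2 ζ t * θ x := by
    intro t x
    have h : deriv (fun s => ζ s * θ x) = fun s => deriv ζ s * θ x :=
      funext fun s => deriv_mul_const_field _
    simp only [iteratedDeriv_succ, iteratedDeriv_zero, h, deriv_mul_const_field]
  have hlap : ∀ (t : ℝ) (x : 𝔼), Laplacian.laplacian (fun y => ζ t * θ y) x
      = ζ t * Laplacian.laplacian θ x := by
    intro t x
    have := InnerProductSpace.laplacian_smul (𝕜 := ℝ) (x := x) (f := θ) (ζ t)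
      (hθ.contDiffAt.of_le (WithTop.coe_le_coe.2 le_top))
    simpa [Pi.smul_def] using this
  simp only [hderiv, hlap] at key
  have hζ2c : Continuous (iteratedDeriv 2 ζ) :=
    hζ.continuous_iteratedDeriv 2 (WithTop.coe_le_coe.2 le_top)
  have hζ20 : ∀ t ∉ Icc c d, iteratedDeriv 2 ζ t = 0 := by
    intro t ht
    have h : ζ =ᶠ[𝓝 t] fun _ => 0 := by
      filter_upwards [isClosed_Icc.isOpen_compl.mem_nhds ht] with s hs using hζ0 s hs
    rw [h.iteratedDeriv_eq]
    simp
  have hlap0 : ∀ x ∉ tsupport θ, Laplacian.laplacian θ x = 0 := by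
    intro x hx
    have h : θ =ᶠ[𝓝 x] fun _ => 0 := notMem_tsupport_iff_eventuallyEq.1 hx
    rw [(InnerProductSpace.laplacian_congr_nhds h).eq_of_nhds]
    simp
  have hI1 := hloc _ (fun z => iteratedDeriv 2 ζ z.1 * θ z.2 - ζ z.1 * Laplacian.laplacian θ z.2)
    h1 (((hζ2c.comp continuous_fst).mul (hθ.continuous.comp continuous_snd)).sub
      ((hζ.continuous.comp continuous_fst).mul ((continuous_laplacian hθ).comp continuous_snd)))
    (by
      intro z hz
      by_cases ht : z.1 ∈ Icc c d
      · have hx : z.2 ∉ tsupport θ := fun hx => hz ⟨ht, hx⟩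
        simp [hlap0 _ hx, image_eq_zero_of_notMem_tsupport hx]
      · simp [hζ0 _ ht, hζ20 _ ht])
  have hI2 := hloc _ (fun z => ζ z.1 * θ z.2) h2 hφ.continuous
    (fun z hz => by_contra fun h => hz (hsub h))
  refine ⟨hI2, ?_⟩
  rw [Measure.volume_eq_prod] at key hI1 hI2
  rw [setIntegral_prod _ hI1, setIntegral_prod _ hI2] at key
  simpa using key

end WeakForm

/-! ### Pairing the solution with exponentials -/

section PlaneWave

variable {n : ℕ}

local notation "𝔼" => EuclideanSpace ℝ (Fin n)

/-- The pairing of `v` with the exponential `exp ⟪ξ, x⟫` on the ball of radius `r`. -/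
noncomputable def expMean (r : ℝ) (ξ : 𝔼) (v : 𝔼 → ℝ) : ℝ :=
  ∫ x in Metric.closedBall 0 r, v x * Real.exp (inner ℝ ξ x)

theorem continuous_exp_inner (ξ : 𝔼) : Continuous fun x : 𝔼 => Real.exp (inner ℝ ξ x) := by
  fun_prop

theorem integral_eq_setIntegral_closedBall {r : ℝ} {v w k : 𝔼 → ℝ}
    (hv : ∀ᵐ x, r < ‖x‖ → v x = 0) (hw : ∀ x, ‖x‖ ≤ r → w x = k x) :
    ∫ x, v x * w x = ∫ x in Metric.closedBall 0 r, v x * k x := by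
  rw [← integral_indicator Metric.isClosed_closedBall.measurableSet]
  refine integral_congr_ae ?_
  filter_upwards [hv] with x hx
  by_cases h : ‖x‖ ≤ r
  · rw [indicator_of_mem (by simpa using h), hw x h]
  · rw [indicator_of_notMem (by simpa using h), hx (not_le.1 h), zero_mul]

theorem exists_cutoff (r : ℝ) : ∃ χ : 𝔼 → ℝ, ContDiff ℝ ∞ χ ∧ HasCompactSupport χ ∧
    ∀ x, ‖x‖ < r → χ x = 1 := by
  let b : ContDiffBump (0 : 𝔼) := ⟨max r 1, max r 1 + 1, by positivity, by linarith⟩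
  refine ⟨b, b.contDiff, b.hasCompactSupport, fun x hx => b.one_of_mem_closedBall ?_⟩
  simpa [b] using Or.inl hx.le

/-- The exponential is not compactly supported, but a cutoff equal to 1 near the support of `u`
changes nothing. The fixed radius `T + R` keeps the domain independent of `t`. Integrability of
almost every relevant slice of `|u|^p` is recorded because Hölder's inequality is later applied
slice by slice, and local integrability in space-time gives it only almost everywhere in time. -/
theorem SolvesWeakly.expMean_eq {p T R : ℝ} (hp : 0 < p) {u : ℝ → 𝔼 → ℝ}
    (hu : SolvesWeakly p T u) (hsupp : ∀ t ∈ Ico 0 T, ∀ᵐ x, t + R < ‖x‖ → u t x = 0)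
    {ζ : ℝ → ℝ} (hζ : ContDiff ℝ ∞ ζ) {c d : ℝ} (hc : 0 < c) (hd : d < T)
    (hζ0 : ∀ t ∉ Icc c d, ζ t = 0) (ξ : 𝔼) :
    (∀ᵐ t ∂volume.restrict (Ioo 0 T), ζ t ≠ 0 → Integrable fun x => |u t x| ^ p) ∧
    IntegrableOn (fun t => ζ t * expMean (T + R) ξ fun x => |u t x| ^ p) (Ioo 0 T) ∧
    ∫ t in Ioo 0 T, (iteratedDeriv 2 ζ t - ‖ξ‖ ^ 2 * ζ t) * expMean (T + R) ξ (u t)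
      = ∫ t in Ioo 0 T, ζ t * expMean (T + R) ξ fun x => |u t x| ^ p := by
  obtain ⟨χ, hχ, hχc, hχ1⟩ := exists_cutoff (n := n) (T + R + 1)
  have hθ : ContDiff ℝ ∞ fun x : 𝔼 => χ x * Real.exp (inner ℝ ξ x) :=
    hχ.mul (Real.contDiff_exp.comp (contDiff_const.inner ℝ contDiff_id))
  have hθc : HasCompactSupport fun x : 𝔼 => χ x * Real.exp (inner ℝ ξ x) := hχc.mul_right
  obtain ⟨hI, heq⟩ := hu.tensor hζ hc hd hζ0 hθ hθc
  have hsupp' : ∀ t ∈ Ioo 0 T, ∀ᵐ x, T + R < ‖x‖ → u t x = 0 := by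
    intro t ht
    filter_upwards [hsupp t ⟨ht.1.le, ht.2⟩] with x hx h
    exact hx (by linarith [ht.2])
  have hsuppp : ∀ t ∈ Ioo 0 T, ∀ᵐ x, T + R < ‖x‖ → |u t x| ^ p = 0 := by
    intro t ht
    filter_upwards [hsupp' t ht] with x hx h
    rw [hx h, abs_zero, Real.zero_rpow hp.ne']
  have hlap : ∀ x : 𝔼, ‖x‖ ≤ T + R →
      Laplacian.laplacian (fun x : 𝔼 => χ x * Real.exp (inner ℝ ξ x)) x
        = ‖ξ‖ ^ 2 * Real.exp (inner ℝ ξ x) := by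
    intro x hx
    have h : (fun x : 𝔼 => χ x * Real.exp (inner ℝ ξ x))
        =ᶠ[𝓝 x] fun x : 𝔼 => Real.exp (inner ℝ ξ x) := by
      have : ∀ᶠ y in 𝓝 x, ‖y‖ < T + R + 1 :=
        continuous_norm.continuousAt.eventually_lt continuousAt_const (by linarith)
      filter_upwards [this] with y hy
      rw [hχ1 y hy, one_mul]
    rw [(InnerProductSpace.laplacian_congr_nhds h).eq_of_nhds, laplacian_exp_inner]
  have hL : ∀ t ∈ Ioo 0 T, ∫ x, u t x * (iteratedDeriv 2 ζ t * (χ x * Real.exp (inner ℝ ξ x))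
      - ζ t * Laplacian.laplacian (fun x : 𝔼 => χ x * Real.exp (inner ℝ ξ x)) x)
      = (iteratedDeriv 2 ζ t - ‖ξ‖ ^ 2 * ζ t) * expMean (T + R) ξ (u t) := by
    intro t ht
    rw [integral_eq_setIntegral_closedBall (hsupp' t ht)
      (k := fun x => (iteratedDeriv 2 ζ t - ‖ξ‖ ^ 2 * ζ t) * Real.exp (inner ℝ ξ x)),
      expMean, ← integral_const_mul]
    · simp only [mul_left_comm]
    · intro x hx
      rw [hlap x hx, hχ1 x (by linarith)]
      ring
  have hRt : ∀ t ∈ Ioo 0 T, ∫ x, |u t x| ^ p * (ζ t * (χ x * Real.exp (inner ℝ ξ x)))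
      = ζ t * expMean (T + R) ξ fun x => |u t x| ^ p := by
    intro t ht
    rw [integral_eq_setIntegral_closedBall (hsuppp t ht)
      (k := fun x => ζ t * Real.exp (inner ℝ ξ x)), expMean, ← integral_const_mul]
    · simp only [mul_left_comm]
    · intro x hx
      rw [hχ1 x (by linarith), one_mul]
  rw [setIntegral_congr_fun measurableSet_Ioo hL, setIntegral_congr_fun measurableSet_Ioo hRt]
    at heq
  have hI' : Integrable (fun z : ℝ × 𝔼 =>
      |u z.1 z.2| ^ p * (ζ z.1 * (χ z.2 * Real.exp (inner ℝ ξ z.2))))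
      ((volume.restrict (Ioo 0 T)).prod volume) := by
    rw [Measure.volume_eq_prod, IntegrableOn, ← Measure.prod_restrict, Measure.restrict_univ] at hI
    exact hI
  refine ⟨?_, ?_, heq⟩
  · filter_upwards [hI'.prod_right_ae, ae_restrict_mem measurableSet_Ioo] with t ht htT hζt
    -- Dividing out the test function, which is nonzero on the ball where the cutoff is 1, recovers
    -- integrability of the slice itself.
    have hcont : ContinuousOn (fun x : 𝔼 => (ζ t)⁻¹ * Real.exp (- inner ℝ ξ x))
      (Metric.closedBall 0 (T + R)) := by fun_prop
    have h1 := (ht.integrableOn (s := Metric.closedBall 0 (T + R))).mul_continuousOn hcont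
      (isCompact_closedBall _ _)
    have h2 : IntegrableOn (fun x => |u t x| ^ p) (Metric.closedBall 0 (T + R)) := by
      refine h1.congr_fun (fun x hx => ?_) Metric.isClosed_closedBall.measurableSet
      have hx' : ‖x‖ ≤ T + R := by simpa using hx
      simp only
      rw [hχ1 x (by linarith), Real.exp_neg]
      field_simp
    rw [← integrable_indicator_iff Metric.isClosed_closedBall.measurableSet] at h2
    refine h2.congr ?_
    filter_upwards [hsuppp t htT] with x hx
    by_cases h : ‖x‖ ≤ T + R
    · rw [indicator_of_mem (by simpa using h)]
    · rw [indicator_of_notMem (by simpa using h), hx (not_le.1 h)]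
  · refine hI'.integral_prod_left.congr ?_
    filter_upwards [ae_restrict_mem measurableSet_Ioo] with t ht
    exact hRt t ht

theorem tendsto_integral_mul_of_eLpNorm {α ι : Type*} [MeasurableSpace α] {μ : Measure α}
    {l : Filter ι} {h : ι → α → ℝ} {k : α → ℝ} (hh : ∀ᶠ s in l, AEStronglyMeasurable (h s) μ)
    (hk : MemLp k 2 μ) (hlim : Tendsto (fun s => eLpNorm (h s) 2 μ) l (𝓝 0)) :
    Tendsto (fun s => ∫ x, h s x * k x ∂μ) l (𝓝 0) := by
  rw [tendsto_zero_iff_enorm_tendsto_zero]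
  have h1 : Tendsto (fun s => eLpNorm (h s) 2 μ * eLpNorm k 2 μ) l (𝓝 0) := by
    have := ENNReal.Tendsto.mul_const hlim (Or.inr hk.2.ne) (b := eLpNorm k 2 μ)
    simpa using this
  refine tendsto_of_tendsto_of_tendsto_of_le_of_le' tendsto_const_nhds h1
    (Eventually.of_forall fun _ => zero_le) ?_
  filter_upwards [hh] with s hs
  calc ‖∫ x, h s x * k x ∂μ‖ₑ ≤ ∫⁻ x, ‖h s x * k x‖ₑ ∂μ := enorm_integral_le_lintegral_enorm _
    _ = eLpNorm (h s • k) 1 μ := by rw [eLpNorm_one_eq_lintegral_enorm]; rfl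
    _ ≤ _ := eLpNorm_smul_le_mul_eLpNorm hk.1 hs

theorem memLp_exp_inner (r : ℝ) (ξ : 𝔼) (q : ℝ≥0∞) :
    MemLp (fun x : 𝔼 => Real.exp (inner ℝ ξ x)) q
      (volume.restrict (Metric.closedBall 0 r)) := by
  have : IsFiniteMeasure (volume.restrict (Metric.closedBall (0 : 𝔼) r)) :=
    ⟨by simpa using (isCompact_closedBall (0 : 𝔼) r).measure_lt_top⟩
  refine MemLp.of_bound (continuous_exp_inner ξ).aestronglyMeasurable (Real.exp (‖ξ‖ * r)) ?_
  filter_upwards [ae_restrict_mem Metric.isClosed_closedBall.measurableSet] with x hx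
  have hx' : ‖x‖ ≤ r := by simpa using hx
  rw [Real.norm_eq_abs, Real.abs_exp]
  exact Real.exp_le_exp.2 ((real_inner_le_norm _ _).trans (by gcongr))

theorem integrableOn_mul_exp_inner {v : 𝔼 → ℝ} (hv : MemLp v 2) (r : ℝ) (ξ : 𝔼) :
    IntegrableOn (fun x => v x * Real.exp (inner ℝ ξ x)) (Metric.closedBall 0 r) :=
  (hv.restrict _).integrable_mul (memLp_exp_inner r ξ 2)

theorem expMean_sub {v w : 𝔼 → ℝ} (hv : MemLp v 2) (hw : MemLp w 2) (r : ℝ) (ξ : 𝔼) :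
    expMean r ξ (fun x => v x - w x) = expMean r ξ v - expMean r ξ w := by
  simp only [expMean, sub_mul]
  exact integral_sub (integrableOn_mul_exp_inner hv r ξ) (integrableOn_mul_exp_inner hw r ξ)

theorem tendsto_expMean_zero {ι : Type*} {l : Filter ι} {h : ι → 𝔼 → ℝ}
    (hh : ∀ᶠ s in l, AEStronglyMeasurable (h s)) (r : ℝ) (ξ : 𝔼)
    (hlim : Tendsto (fun s => eLpNorm (h s) 2) l (𝓝 0)) :
    Tendsto (fun s => expMean r ξ (h s)) l (𝓝 0) :=
  tendsto_integral_mul_of_eLpNorm (hh.mono fun _ hs => hs.restrict) (memLp_exp_inner r ξ 2)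
    (tendsto_of_tendsto_of_tendsto_of_le_of_le tendsto_const_nhds hlim (fun _ => zero_le)
      fun _ => eLpNorm_mono_measure _ Measure.restrict_le_self)

theorem ContinuousL2.continuousOn_expMean {T : ℝ} {v : ℝ → 𝔼 → ℝ} (hv : ContinuousL2 T v)
    (r : ℝ) (ξ : 𝔼) : ContinuousOn (fun t => expMean r ξ (v t)) (Ico 0 T) := by
  intro t ht
  have h := tendsto_expMean_zero (l := 𝓝[Ico 0 T] t) (h := fun s => v s - v t)
    (by
      filter_upwards [self_mem_nhdsWithin] with s hs
      exact (hv.1 s hs).1.sub (hv.1 t ht).1) r ξ (hv.2 t ht)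
  rw [ContinuousWithinAt, ← tendsto_sub_nhds_zero_iff]
  refine h.congr' ?_
  filter_upwards [self_mem_nhdsWithin] with s hs
  exact expMean_sub (hv.1 s hs) (hv.1 t ht) r ξ

/-- The exponential is square integrable on the ball, so by Cauchy–Schwarz the `L²` convergence of
difference quotients passes to the pairing. -/
theorem IsTimeDerivative.hasDerivWithinAt_expMean {T : ℝ} {u ut : ℝ → 𝔼 → ℝ}
    (h : IsTimeDerivative T u ut) (hu : ∀ t ∈ Ico 0 T, MemLp (u t) 2)
    (hut : ∀ t ∈ Ico 0 T, MemLp (ut t) 2) (r : ℝ) (ξ : 𝔼) {t : ℝ} (ht : t ∈ Ico 0 T) :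
    HasDerivWithinAt (fun t => expMean r ξ (u t)) (expMean r ξ (ut t)) (Ico 0 T) t := by
  have hq : ∀ s ∈ Ico 0 T, MemLp (fun x => (u s x - u t x) / (s - t)) 2 := by
    intro s hs
    have := ((hu s hs).sub (hu t ht)).const_mul (s - t)⁻¹
    refine this.ae_eq (Eventually.of_forall fun x => ?_)
    simp [div_eq_inv_mul]
  rw [hasDerivWithinAt_iff_tendsto_slope, ← tendsto_sub_nhds_zero_iff]
  refine (tendsto_expMean_zero (l := 𝓝[Ico 0 T \ {t}] t) ?_ r ξ (h t ht)).congr' ?_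
  · filter_upwards [self_mem_nhdsWithin] with s hs
    exact (hq s hs.1).1.sub (hut t ht).1
  · filter_upwards [self_mem_nhdsWithin] with s hs
    rw [expMean_sub (hq s hs.1) (hut t ht), slope_def_field, ← expMean_sub (hu s hs.1) (hu t ht)]
    congr 1
    simp only [expMean, ← integral_div]
    refine integral_congr_ae (Eventually.of_forall fun x => ?_)
    simp only
    ring

end PlaneWave

/-! ### The weak evolution law of the plane-wave momentum -/

section Momentum

variable {n : ℕ}

local notation "𝔼" => EuclideanSpace ℝ (Fin n)

theorem integrableOn_of_continuousOn_Icc {T c d : ℝ} {w : ℝ → ℝ} (hw : ContinuousOn w (Icc c d))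
    (h0 : ∀ t ∉ Icc c d, w t = 0) : IntegrableOn w (Ioo 0 T) :=
  (((hw.integrableOn_compact isCompact_Icc).of_forall_sdiff_eq_zero MeasurableSet.univ
    fun t ht => h0 t ht.2).integrable_of_forall_notMem_eq_zero
      fun _ h => absurd (mem_univ _) h).integrableOn

theorem integral_derivative_eq_zero {T c d : ℝ} {W W' : ℝ → ℝ} (hc : 0 < c) (hd : d < T)
    (hW : ∀ t ∈ Ioo 0 T, HasDerivAt W (W' t) t) (hcont : ContinuousOn W' (Icc c d))
    (h0 : ∀ t ∉ Icc c d, W t = 0) (h0' : ∀ t ∉ Icc c d, W' t = 0) :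
    ∫ t in Ioo 0 T, W' t = 0 := by
  have hsub : Icc c d ⊆ Ioo 0 T := fun t ht => ⟨hc.trans_le ht.1, ht.2.trans_lt hd⟩
  have hint : ∀ w : ℝ → ℝ, ContinuousOn w (Icc c d) → (∀ t ∉ Icc c d, w t = 0) →
      Integrable w := fun w hw h =>
    (hw.integrableOn_compact isCompact_Icc).integrable_of_forall_notMem_eq_zero h
  rw [setIntegral_eq_integral_of_forall_compl_eq_zero fun t ht => h0' t fun h => ht (hsub h)]
  refine integral_eq_zero_of_hasDerivAt_of_integrable (f := W) (fun t => ?_) (hint _ hcont h0')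
    (hint _ (fun t ht => (hW t (hsub ht)).continuousAt.continuousWithinAt) h0)
  by_cases ht : t ∈ Icc c d
  · exact hW t (hsub ht)
  · rw [h0' t ht]
    refine (hasDerivAt_const t (0 : ℝ)).congr_of_eventuallyEq ?_
    filter_upwards [isClosed_Icc.isOpen_compl.mem_nhds ht] with s hs using h0 s hs

/-- The quantity `∂ₜ F + 2 ‖ξ‖ F`, where `F` is the pairing of the solution with the plane wave
`exp (⟪ξ, x⟫ - ‖ξ‖ t)`. -/
noncomputable def planeMomentum (r : ℝ) (ξ : 𝔼) (u ut : ℝ → 𝔼 → ℝ) (t : ℝ) : ℝ :=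
  Real.exp (-(‖ξ‖ * t)) * (expMean r ξ (ut t) + ‖ξ‖ * expMean r ξ (u t))

variable {p R ε T : ℝ} {f g : EuclideanSpace ℝ (Fin n) → ℝ}
  {u ut : ℝ → EuclideanSpace ℝ (Fin n) → ℝ}

theorem IsSolution.hasDerivWithinAt_expMean (sol : IsSolution p f g R ε T u ut) (r : ℝ) (ξ : 𝔼)
    {t : ℝ} (ht : t ∈ Ico 0 T) :
    HasDerivWithinAt (fun t => expMean r ξ (u t)) (expMean r ξ (ut t)) (Ico 0 T) t :=
  sol.time_derivative.hasDerivWithinAt_expMean sol.continuous_u.1.1 sol.continuous_ut.1 r ξ ht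

theorem IsSolution.continuousOn_planeMomentum (sol : IsSolution p f g R ε T u ut) (r : ℝ)
    (ξ : 𝔼) : ContinuousOn (planeMomentum r ξ u ut) (Ico 0 T) := by
  have h1 := sol.continuous_u.1.continuousOn_expMean r ξ
  have h2 := sol.continuous_ut.continuousOn_expMean r ξ
  unfold planeMomentum
  fun_prop

/-- The time factor `ζ = η e`, with `e = exp (-‖ξ‖ t)`, satisfies `ζ'' - ‖ξ‖² ζ = (η'' - 2 ‖ξ‖ η')
e`. No undifferentiated `η` survives, so one integration by parts leaves only `η'` times the
momentum. -/
theorem IsSolution.integral_deriv_mul_planeMomentum (sol : IsSolution p f g R ε T u ut)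
    (hp : 0 < p) (ξ : 𝔼) {η : ℝ → ℝ} (hη : ContDiff ℝ ∞ η) {c d : ℝ} (hc : 0 < c) (hd : d < T)
    (hη0 : ∀ t ∉ Icc c d, η t = 0) :
    (∀ᵐ t ∂volume.restrict (Ioo 0 T), η t ≠ 0 → Integrable fun x => |u t x| ^ p) ∧
    IntegrableOn (fun t => η t * (Real.exp (-(‖ξ‖ * t)) *
      expMean (T + R) ξ fun x => |u t x| ^ p)) (Ioo 0 T) ∧
    ∫ t in Ioo 0 T, -(deriv η t * planeMomentum (T + R) ξ u ut t)
      = ∫ t in Ioo 0 T, η t * (Real.exp (-(‖ξ‖ * t)) *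
          expMean (T + R) ξ fun x => |u t x| ^ p) := by
  set a := ‖ξ‖ with ha
  set U := fun t => expMean (T + R) ξ (u t) with hU
  set V := fun t => expMean (T + R) ξ (ut t) with hV
  set e : ℝ → ℝ := fun t => Real.exp (-(a * t)) with he
  have hsub : Icc c d ⊆ Ioo 0 T := fun t ht => ⟨hc.trans_le ht.1, ht.2.trans_lt hd⟩
  have hsub' : Icc c d ⊆ Ico 0 T := fun t ht => ⟨hc.le.trans ht.1, ht.2.trans_lt hd⟩
  have hed : ∀ t, HasDerivAt e (-(a * e t)) t := by
    intro t
    have h := (((hasDerivAt_id' t).const_mul a).fun_neg).exp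
    refine h.congr_deriv ?_
    simp only [he]
    ring
  have hesm : ContDiff ℝ ∞ e := by
    have : ContDiff ℝ ∞ fun t : ℝ => -(a * t) := by fun_prop
    exact Real.contDiff_exp.comp this
  have hη1 : ContDiff ℝ ∞ (deriv η) := (contDiff_infty_iff_deriv.1 hη).2
  have hηd : ∀ t, HasDerivAt η (deriv η t) t := fun t =>
    ((contDiff_infty_iff_deriv.1 hη).1 t).hasDerivAt
  have hη1d : ∀ t, HasDerivAt (deriv η) (deriv (deriv η) t) t := fun t =>
    ((contDiff_infty_iff_deriv.1 hη1).1 t).hasDerivAt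
  have hη2c : Continuous (deriv (deriv η)) := (contDiff_infty_iff_deriv.1 hη1).2.continuous
  have hder0 : ∀ w : ℝ → ℝ, (∀ t ∉ Icc c d, w t = 0) → ∀ t ∉ Icc c d, deriv w t = 0 := by
    intro w hw t ht
    have h : w =ᶠ[𝓝 t] fun _ => 0 := by
      filter_upwards [isClosed_Icc.isOpen_compl.mem_nhds ht] with s hs using hw s hs
    rw [h.deriv_eq, deriv_const]
  have hη10 := hder0 η hη0
  have hη20 := hder0 _ hη10
  obtain ⟨h1, h2, h3⟩ := sol.equation.expMean_eq hp sol.support_u (ζ := fun t => η t * e t)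
    (hη.mul hesm) hc hd (fun t ht => by simp [hη0 t ht]) ξ
  have hζ2 : ∀ t, iteratedDeriv 2 (fun t => η t * e t) t
      = (deriv (deriv η) t - 2 * a * deriv η t + a ^ 2 * η t) * e t := by
    intro t
    have hd1 : deriv (fun t => η t * e t) = fun t => deriv η t * e t + η t * (-(a * e t)) :=
      funext fun t => ((hηd t).mul (hed t)).deriv
    have hd2 := ((hη1d t).mul (hed t)).add ((hηd t).mul ((hed t).const_mul a).fun_neg)
    simp only [iteratedDeriv_succ, iteratedDeriv_zero, hd1]
    refine hd2.deriv.trans ?_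
    ring
  have hVc : ContinuousOn V (Ico 0 T) := sol.continuous_ut.continuousOn_expMean _ ξ
  have hUc : ContinuousOn U (Ico 0 T) := sol.continuous_u.1.continuousOn_expMean _ ξ
  have hUd : ∀ t ∈ Ioo 0 T, HasDerivAt U (V t) t := fun t ht =>
    (sol.hasDerivWithinAt_expMean (T + R) ξ ⟨ht.1.le, ht.2⟩).hasDerivAt
      (Ico_mem_nhds ht.1 ht.2)
  -- The exact derivative of `η' e U` integrates to zero and trades `η''` for `η'`.
  set W := fun t => deriv η t * (e t * U t) with hW
  set W' := fun t => deriv (deriv η) t * (e t * U t)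
    + deriv η t * (-(a * e t) * U t + e t * V t) with hW'
  have hVc' := hVc.mono hsub'
  have hUc' := hUc.mono hsub'
  have hec : Continuous e := hesm.continuous
  have hη1c : Continuous (deriv η) := hη1.continuous
  have hW'c : ContinuousOn W' (Icc c d) := by
    simp only [hW']
    fun_prop
  have hzero : ∫ t in Ioo 0 T, W' t = 0 := by
    refine integral_derivative_eq_zero (W := W) hc hd (fun t ht => ?_) hW'c ?_ ?_
    · exact (hη1d t).mul ((hed t).mul (hUd t ht))
    · intro t ht; simp [hW, hη10 t ht]
    · intro t ht; simp [hW', hη10 t ht, hη20 t ht]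
  have hPc := (sol.continuousOn_planeMomentum (T + R) ξ).mono hsub'
  have hPi : IntegrableOn (fun t => -(deriv η t * planeMomentum (T + R) ξ u ut t)) (Ioo 0 T) :=
    integrableOn_of_continuousOn_Icc (c := c) (d := d) (by fun_prop)
      (fun t ht => by simp [hη10 t ht])
  have hW'i : IntegrableOn W' (Ioo 0 T) :=
    integrableOn_of_continuousOn_Icc hW'c (fun t ht => by simp [hW', hη10 t ht, hη20 t ht])
  refine ⟨?_, ?_, ?_⟩
  · filter_upwards [h1] with t ht h
    exact ht (mul_ne_zero h (Real.exp_pos _).ne')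
  · refine h2.congr_fun (fun t _ => ?_) measurableSet_Ioo
    simp only [he]
    ring
  · have h4 : ∫ t in Ioo 0 T, (iteratedDeriv 2 (fun t => η t * e t) t - a ^ 2 * (η t * e t)) * U t
        = ∫ t in Ioo 0 T, -(deriv η t * planeMomentum (T + R) ξ u ut t) := by
      have hadd := integral_add hPi hW'i
      rw [hzero, add_zero] at hadd
      rw [← hadd]
      refine integral_congr_ae (Eventually.of_forall fun t => ?_)
      simp only [hζ2, hW', planeMomentum, ← ha]
      simp only [hU, hV, he]
      ring
    rw [← h4, h3]
    simp only [he, mul_assoc]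

end Momentum

/-! ### From a weak derivative bound to increments -/

section Increment

theorem smoothTransition_deriv_nonneg (x : ℝ) : 0 ≤ deriv Real.smoothTransition x :=
  Real.smoothTransition.monotone.deriv_nonneg

/-- A continuous function whose distributional derivative is at least `m ≥ 0`. -/
theorem increment_ge_of_integral_deriv {T s t t₀ m : ℝ} {P : ℝ → ℝ}
    (hP : ContinuousOn P (Ico 0 T)) (hs : 0 < s) (hst : s < t) (ht : t < t₀) (hT : t₀ ≤ T)
    (hm : 0 ≤ m)
    (H : ∀ η : ℝ → ℝ, ContDiff ℝ ∞ η → (∀ r, 0 ≤ η r) → ∀ d < t₀, (∀ r ∉ Icc s d, η r = 0) →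
      ∫ r in Ioo 0 T, η r * m ≤ ∫ r in Ioo 0 T, -(deriv η r * P r)) :
    m * (t - s) ≤ P t - P s := by
  refine le_of_forall_pos_le_add fun κ hκ => ?_
  have hPs : ContinuousAt P s := hP.continuousAt (Ico_mem_nhds hs (by linarith))
  have hPt : ContinuousAt P t := hP.continuousAt (Ico_mem_nhds (by linarith) (by linarith))
  obtain ⟨δ₁, hδ₁, h₁⟩ := Metric.continuousAt_iff.1 hPs (κ / 3) (by positivity)
  obtain ⟨δ₂, hδ₂, h₂⟩ := Metric.continuousAt_iff.1 hPt (κ / 3) (by positivity)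
  -- The first two bounds give continuity at `s` and `t`, the third leaves a plateau `[s + δ, t]`,
  -- the fourth keeps the support before `t₀`. The last makes the plateau's shortening cost at most
  -- `κ / 3`.
  obtain ⟨δ, hδ, hδ1, hδ2, hδ3, hδ4, hδ5⟩ : ∃ δ > 0, δ < δ₁ ∧ δ < δ₂ ∧ δ < t - s ∧ δ < t₀ - t ∧
      m * δ ≤ κ / 3 := by
    refine ⟨min (min (δ₁ / 2) (δ₂ / 2)) (min (min ((t - s) / 2) ((t₀ - t) / 2))
      (κ / 3 / (m + 1))), ?_, ?_, ?_, ?_, ?_, ?_⟩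
    · have : 0 < t - s := by linarith
      have : 0 < t₀ - t := by linarith
      positivity
    · exact ((min_le_left _ _).trans (min_le_left _ _)).trans_lt (by linarith)
    · exact ((min_le_left _ _).trans (min_le_right _ _)).trans_lt (by linarith)
    · exact (((min_le_right _ _).trans (min_le_left _ _)).trans (min_le_left _ _)).trans_lt
        (by linarith)
    · exact (((min_le_right _ _).trans (min_le_left _ _)).trans (min_le_right _ _)).trans_lt
        (by linarith)
    · calc m * _ ≤ (m + 1) * (κ / 3 / (m + 1)) := by
            refine mul_le_mul (by linarith) ((min_le_right _ _).trans (min_le_right _ _)) ?_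
              (by linarith)
            have : 0 < t - s := by linarith
            have : 0 < t₀ - t := by linarith
            positivity
        _ = κ / 3 := by field_simp
  set S : ℝ → ℝ → ℝ := fun q r => Real.smoothTransition ((r - q) / δ) with hS
  set D : ℝ → ℝ → ℝ := fun q r => deriv Real.smoothTransition ((r - q) / δ) / δ with hD
  have hSsm : ∀ q, ContDiff ℝ ∞ (S q) := fun q =>
    Real.smoothTransition.contDiff.comp (by fun_prop)
  have hSd : ∀ q r, HasDerivAt (S q) (D q r) r := by
    intro q r
    have h1 : HasDerivAt Real.smoothTransition (deriv Real.smoothTransition ((r - q) / δ))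
        ((r - q) / δ) :=
      ((Real.smoothTransition.contDiff (n := 1)).differentiable (by norm_num) _).hasDerivAt
    have h2 : HasDerivAt (fun r : ℝ => (r - q) / δ) (1 / δ) r :=
      ((hasDerivAt_id r).sub_const q).div_const δ
    refine (h1.comp r h2).congr_deriv ?_
    simp only [hD]; ring
  have hSmono : ∀ q, Monotone (S q) := fun q x y hxy =>
    Real.smoothTransition.monotone (by gcongr)
  have hD0 : ∀ q r, 0 ≤ D q r := fun q r =>
    div_nonneg (smoothTransition_deriv_nonneg _) hδ.le
  have hS0 : ∀ q r, r ≤ q → S q r = 0 := fun q r h =>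
    Real.smoothTransition.zero_of_nonpos (div_nonpos_of_nonpos_of_nonneg (by linarith) hδ.le)
  have hS1 : ∀ q r, q + δ ≤ r → S q r = 1 := fun q r h =>
    Real.smoothTransition.one_of_one_le ((one_le_div hδ).2 (by linarith))
  have hDc : ∀ q, Continuous (D q) := fun q => by
    have : deriv (S q) = D q := funext fun r => (hSd q r).deriv
    rw [← this]
    exact (contDiff_infty_iff_deriv.1 (hSsm q)).2.continuous
  have hDz : ∀ q r, r ∉ Icc q (q + δ) → D q r = 0 := by
    intro q r hr
    rw [← (hSd q r).deriv]
    rcases not_and_or.1 hr with h | h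
    · have h : S q =ᶠ[𝓝 r] fun _ => 0 := by
        filter_upwards [Iio_mem_nhds (not_le.1 h)] with x hx using hS0 q x (le_of_lt hx)
      rw [h.deriv_eq, deriv_const]
    · have h : S q =ᶠ[𝓝 r] fun _ => 1 := by
        filter_upwards [Ioi_mem_nhds (not_le.1 h)] with x hx using hS1 q x (le_of_lt hx)
      rw [h.deriv_eq, deriv_const]
  have hDint : ∀ q, 0 < q → q + δ < T → ∫ r in Ioo 0 T, D q r = 1 := by
    intro q hq hqT
    rw [← integral_Ioc_eq_integral_Ioo, ← intervalIntegral.integral_of_le (by linarith),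
      intervalIntegral.integral_eq_sub_of_hasDerivAt (fun r _ => hSd q r)
        ((hDc q).intervalIntegrable _ _), hS1 q T hqT.le, hS0 q 0 hq.le, sub_zero]
  -- A smoothed indicator of `[s, t]`: `-η'` has mass `1` on `[t, t + δ]` and mass `-1` on `[s, s +
  -- δ]`, so pairing it with `P` nearly gives `P t - P s`.
  set η : ℝ → ℝ := fun r => S s r - S t r with hη
  have hηd : ∀ r, deriv η r = D s r - D t r := fun r => ((hSd s r).sub (hSd t r)).deriv
  have hη0 : ∀ r, 0 ≤ η r := fun r => by
    refine sub_nonneg.2 (Real.smoothTransition.monotone ?_)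
    gcongr
  have hηz : ∀ r ∉ Icc s (t + δ), η r = 0 := by
    intro r hr
    rcases not_and_or.1 hr with h | h
    · simp [hη, hS0 s r (not_le.1 h).le, hS0 t r (by linarith)]
    · simp [hη, hS1 t r (not_le.1 h).le, hS1 s r (by linarith)]
  have hηsm : ContDiff ℝ ∞ η := (hSsm s).sub (hSsm t)
  have key := H η hηsm hη0 (t + δ) (by linarith) hηz
  have hsub : Icc s (t + δ) ⊆ Ico 0 T := fun r hr => ⟨hs.le.trans hr.1, by linarith [hr.2]⟩
  have hPc := hP.mono hsub
  have hηc : Continuous (deriv η) := (contDiff_infty_iff_deriv.1 hηsm).2.continuous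
  have hlow : m * (t - s - δ) ≤ ∫ r in Ioo 0 T, η r * m := by
    have hi : IntegrableOn (fun r => η r * m) (Ioo 0 T) :=
      integrableOn_of_continuousOn_Icc (c := s) (d := t + δ)
        (hηsm.continuous.mul continuous_const).continuousOn (fun r hr => by simp [hηz r hr])
    calc m * (t - s - δ) = ∫ r in Icc (s + δ) t, m := by
          rw [setIntegral_const]
          simp [Real.volume_real_Icc, max_eq_left (show 0 ≤ t - (s + δ) by linarith)]
          ring
      _ = ∫ r in Icc (s + δ) t, η r * m := by
          refine setIntegral_congr_fun measurableSet_Icc fun r hr => ?_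
          simp [hη, hS1 s r hr.1, hS0 t r hr.2]
      _ ≤ ∫ r in Ioo 0 T, η r * m := by
          refine setIntegral_mono_set hi (Eventually.of_forall fun r => mul_nonneg (hη0 r) hm) ?_
          exact LE.le.eventuallyLE
            fun r hr => ⟨by linarith [hr.1], by linarith [hr.2]⟩
  have hup : ∫ r in Ioo 0 T, -(deriv η r * P r) ≤ P t - P s + 2 * (κ / 3) := by
    have hi : ∀ q, 0 < q → q + δ < T → ∀ b : ℝ, IntegrableOn (fun r => D q r * b) (Ioo 0 T) :=
      fun q hq hqT b => integrableOn_of_continuousOn_Icc (c := q) (d := q + δ)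
        ((hDc q).mul continuous_const).continuousOn (fun r hr => by simp [hDz q r hr])
    calc ∫ r in Ioo 0 T, -(deriv η r * P r)
        ≤ ∫ r in Ioo 0 T, (D t r * (P t + κ / 3) - D s r * (P s - κ / 3)) := by
          refine setIntegral_mono_on ?_ ((hi t (by linarith) (by linarith) _).sub
            (hi s hs (by linarith) _)) measurableSet_Ioo fun r hr => ?_
          · refine integrableOn_of_continuousOn_Icc (c := s) (d := t + δ) (by fun_prop) ?_
            intro r hr
            have h1 : D s r = 0 := hDz s r fun h => hr ⟨h.1, by linarith [h.2]⟩
            have h2 : D t r = 0 := hDz t r fun h => hr ⟨by linarith [h.1], h.2⟩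
            simp [hηd, h1, h2]
          · have e1 : D s r * (P s - κ / 3) ≤ D s r * P r := by
              by_cases h : r ∈ Icc s (s + δ)
              · refine mul_le_mul_of_nonneg_left ?_ (hD0 s r)
                have := h₁ (x := r) (by rw [Real.dist_eq, abs_lt]; constructor <;> linarith [h.1, h.2])
                rw [Real.dist_eq, abs_lt] at this
                linarith
              · simp [hDz s r h]
            have e2 : D t r * P r ≤ D t r * (P t + κ / 3) := by
              by_cases h : r ∈ Icc t (t + δ)
              · refine mul_le_mul_of_nonneg_left ?_ (hD0 t r)
                have := h₂ (x := r) (by rw [Real.dist_eq, abs_lt]; constructor <;> linarith [h.1, h.2])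
                rw [Real.dist_eq, abs_lt] at this
                linarith
              · simp [hDz t r h]
            rw [hηd]
            linarith
      _ = P t - P s + 2 * (κ / 3) := by
          rw [integral_sub (hi t (by linarith) (by linarith) _) (hi s hs (by linarith) _),
            integral_mul_const, integral_mul_const, hDint t (by linarith) (by linarith),
            hDint s hs (by linarith)]
          ring
  nlinarith [key, hlow, hup]

end Increment

/-! ### Growth of the momentum -/

section Momentum

variable {n : ℕ} {p R ε T : ℝ} {f g : EuclideanSpace ℝ (Fin n) → ℝ}
  {u ut : ℝ → EuclideanSpace ℝ (Fin n) → ℝ}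

/-- The lower bound is asked only on slices where `|u|^p` is integrable: almost every slice seen by
the test function is one. The gap between `t` and `t₀` leaves room for the test function to descend
to zero. -/
theorem IsSolution.planeMomentum_increment (sol : IsSolution p f g R ε T u ut) (hp : 0 < p)
    (ξ : EuclideanSpace ℝ (Fin n)) {s t t₀ m : ℝ} (hs : 0 < s) (hst : s ≤ t) (ht : t < t₀)
    (hT : t₀ ≤ T) (hm : 0 ≤ m)
    (H : ∀ r ∈ Ico s t₀, (Integrable fun x => |u r x| ^ p) →
      m ≤ Real.exp (-(‖ξ‖ * r)) * expMean (T + R) ξ fun x => |u r x| ^ p) :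
    m * (t - s) ≤ planeMomentum (T + R) ξ u ut t - planeMomentum (T + R) ξ u ut s := by
  rcases hst.eq_or_lt with rfl | hst
  · simp
  refine increment_ge_of_integral_deriv (sol.continuousOn_planeMomentum _ ξ) hs hst ht hT hm ?_
  intro η hη hη0 d hd hηz
  obtain ⟨h1, h2, h3⟩ :=
    sol.integral_deriv_mul_planeMomentum hp ξ hη hs (hd.trans_le hT) hηz
  rw [h3]
  refine setIntegral_mono_ae_restrict ?_ h2 ?_
  · exact integrableOn_of_continuousOn_Icc (c := s) (d := d)
      (hη.continuous.mul continuous_const).continuousOn (fun r hr => by simp [hηz r hr])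
  · filter_upwards [h1] with r hr
    by_cases h : η r = 0
    · simp [h]
    · have hrs : r ∈ Icc s d := by_contra fun h' => h (hηz r h')
      exact mul_le_mul_of_nonneg_left (H r ⟨hrs.1, hrs.2.trans_lt hd⟩ (hr h)) (hη0 r)

end Momentum

/-! ### Linear lower bounds from the initial data -/

section LowerBounds

variable {n : ℕ} {p R ε T : ℝ} {f g : EuclideanSpace ℝ (Fin n) → ℝ}
  {u ut : ℝ → EuclideanSpace ℝ (Fin n) → ℝ}

local notation "𝔼" => EuclideanSpace ℝ (Fin n)

theorem integrableOn_mul_exp_neg_norm {g : 𝔼 → ℝ} (hg : MemLp g 2) (r : ℝ) :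
    IntegrableOn (fun x => g x * Real.exp (-‖x‖)) (Metric.closedBall 0 r) := by
  have h := integrableOn_mul_exp_inner hg r 0
  simp only [inner_zero_left, Real.exp_zero, mul_one] at h
  exact h.mul_continuousOn (by fun_prop) (isCompact_closedBall _ _)

theorem integral_mul_exp_neg_norm_pos {g : 𝔼 → ℝ} (hg : MemLp g 2) (hg_nonneg : ∀ᵐ x, 0 ≤ g x)
    (hg_supp : ∃ K : Set 𝔼, IsCompact K ∧ ∀ᵐ x, x ∉ K → g x = 0)
    (hg_ne : ¬ ∀ᵐ x, g x = 0) : 0 < ∫ x, g x * Real.exp (-‖x‖) := by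
  obtain ⟨K, hK, hgK⟩ := hg_supp
  obtain ⟨r, hr⟩ := hK.isBounded.subset_closedBall (0 : 𝔼)
  have hi : Integrable fun x => g x * Real.exp (-‖x‖) := by
    refine ((integrable_indicator_iff Metric.isClosed_closedBall.measurableSet).2
      (integrableOn_mul_exp_neg_norm hg r)).congr ?_
    filter_upwards [hgK] with x hx
    by_cases h : x ∈ Metric.closedBall (0 : 𝔼) r
    · rw [indicator_of_mem h]
    · rw [indicator_of_notMem h, hx (fun h' => h (hr h')), zero_mul]
  have h0 : 0 ≤ᵐ[volume] fun x => g x * Real.exp (-‖x‖) := by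
    filter_upwards [hg_nonneg] with x hx using mul_nonneg hx (Real.exp_pos _).le
  refine (integral_nonneg_of_ae h0).lt_of_ne fun h => hg_ne ?_
  filter_upwards [(integral_eq_zero_iff_of_nonneg_ae h0 hi).1 h.symm] with x hx
  exact (mul_eq_zero.1 hx).resolve_right (Real.exp_pos _).ne'

theorem expMean_const_mul (r : ℝ) (ξ : 𝔼) (c : ℝ) (v : 𝔼 → ℝ) :
    expMean r ξ (fun x => c * v x) = c * expMean r ξ v := by
  simp only [expMean, mul_assoc, integral_const_mul]

theorem expMean_congr (r : ℝ) (ξ : 𝔼) {v w : 𝔼 → ℝ} (h : ∀ᵐ x, v x = w x) :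
    expMean r ξ v = expMean r ξ w :=
  integral_congr_ae ((ae_restrict_of_ae h).mono fun x hx => by simp only [hx])

theorem expMean_nonneg (r : ℝ) (ξ : 𝔼) {v : 𝔼 → ℝ} (h : ∀ᵐ x, 0 ≤ v x) :
    0 ≤ expMean r ξ v :=
  integral_nonneg_of_ae ((ae_restrict_of_ae h).mono fun _ hx => mul_nonneg hx (Real.exp_pos _).le)

theorem IsSolution.expMean_zero_nonneg (sol : IsSolution p f g R ε T u ut) (hε : 0 < ε)
    (hf_nonneg : ∀ᵐ x, 0 ≤ f x) (r : ℝ) (ξ : 𝔼) : 0 ≤ expMean r ξ (u 0) := by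
  rw [expMean_congr r ξ sol.initial_u, expMean_const_mul]
  exact mul_nonneg hε.le (expMean_nonneg r ξ hf_nonneg)

/-- For `‖ξ‖ ≤ 1` one has `⟪ξ, x⟫ ≥ -‖x‖`, so the contribution of `g` is bounded below uniformly in
`ξ`; that of `f` is nonnegative. -/
theorem IsSolution.planeMomentum_zero_ge (sol : IsSolution p f g R ε T u ut) (hε : 0 < ε)
    (hT : 0 < T) (hg : MemLp g 2) (hf_nonneg : ∀ᵐ x, 0 ≤ f x) (hg_nonneg : ∀ᵐ x, 0 ≤ g x)
    {ξ : 𝔼} (hξ : ‖ξ‖ ≤ 1) :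
    ε * ∫ x, g x * Real.exp (-‖x‖) ≤ planeMomentum (T + R) ξ u ut 0 := by
  have h0 : (0 : ℝ) ∈ Ico 0 T := ⟨le_rfl, hT⟩
  -- `R` is not tied to the support of `g` by hypothesis; the support condition on the solution at
  -- time 0 supplies the link.
  have hgz : ∀ᵐ x, T + R < ‖x‖ → g x = 0 := by
    filter_upwards [sol.support_ut 0 h0, sol.initial_ut] with x h1 h2 h3
    rw [h1 (by linarith)] at h2
    exact (mul_eq_zero.1 h2.symm).resolve_left hε.ne'
  have h1 : ∫ x, g x * Real.exp (-‖x‖) ≤ expMean (T + R) ξ g := by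
    rw [integral_eq_setIntegral_closedBall hgz fun _ _ => rfl]
    refine setIntegral_mono_ae_restrict (integrableOn_mul_exp_neg_norm hg _)
      (integrableOn_mul_exp_inner hg _ ξ) ?_
    filter_upwards [ae_restrict_of_ae hg_nonneg] with x hx
    refine mul_le_mul_of_nonneg_left (Real.exp_le_exp.2 ?_) hx
    have := abs_le.1 (abs_real_inner_le_norm ξ x)
    nlinarith [norm_nonneg x, norm_nonneg ξ]
  have h2 := mul_le_mul_of_nonneg_left h1 hε.le
  have h3 := mul_nonneg (norm_nonneg ξ) (sol.expMean_zero_nonneg hε hf_nonneg (T + R) ξ)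
  rw [planeMomentum, expMean_congr _ ξ sol.initial_ut, expMean_const_mul]
  simp only [mul_zero, neg_zero, Real.exp_zero, one_mul]
  linarith

theorem IsSolution.planeMomentum_ge (sol : IsSolution p f g R ε T u ut) (hp : 0 < p)
    (hε : 0 < ε) (hg : MemLp g 2) (hf_nonneg : ∀ᵐ x, 0 ≤ f x) (hg_nonneg : ∀ᵐ x, 0 ≤ g x)
    {ξ : 𝔼} (hξ : ‖ξ‖ ≤ 1) {t : ℝ} (ht : t ∈ Ico 0 T) :
    ε * ∫ x, g x * Real.exp (-‖x‖) ≤ planeMomentum (T + R) ξ u ut t := by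
  have hT : 0 < T := ht.1.trans_lt ht.2
  have h0 := sol.planeMomentum_zero_ge hε hT hg hf_nonneg hg_nonneg hξ
  rcases ht.1.eq_or_lt with rfl | ht0
  · exact h0
  -- Test functions live in positive times, so monotonicity is known only from `s > 0`; continuity
  -- lets `s` tend to 0.
  have hc : Tendsto (planeMomentum (T + R) ξ u ut) (𝓝[>] 0)
      (𝓝 (planeMomentum (T + R) ξ u ut 0)) := by
    refine (sol.continuousOn_planeMomentum (T + R) ξ 0 ⟨le_rfl, hT⟩).tendsto.mono_left ?_
    exact nhdsWithin_le_of_mem (mem_of_superset (Ioo_mem_nhdsGT hT) Ioo_subset_Ico_self)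
  refine h0.trans (le_of_tendsto hc ?_)
  filter_upwards [Ioo_mem_nhdsGT ht0] with s hs
  have := sol.planeMomentum_increment hp ξ (m := 0) hs.1 hs.2.le ht.2 le_rfl le_rfl
    fun r _ _ => mul_nonneg (Real.exp_pos _).le (expMean_nonneg _ _ (Eventually.of_forall
      fun x => Real.rpow_nonneg (abs_nonneg _) _))
  linarith

/-- The momentum bound reads `V + U ≥ c exp t`, that is `(exp t * U)' ≥ c exp (2 t)`. Integrating
from `U 0 ≥ 0` gives `exp t * U ≥ c / 2 * (exp (2 t) - 1)`, and once `exp (2 t) ≥ 2` the right side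
is at least `c / 4 * exp (2 t)`. -/
theorem IsSolution.expMean_ge (sol : IsSolution p f g R ε T u ut) (hp : 0 < p)
    (hε : 0 < ε) (hg : MemLp g 2) (hf_nonneg : ∀ᵐ x, 0 ≤ f x) (hg_nonneg : ∀ᵐ x, 0 ≤ g x)
    {ξ : 𝔼} (hξ : ‖ξ‖ = 1) {t : ℝ} (ht1 : 1 ≤ t) (htT : t < T) :
    ε * (∫ x, g x * Real.exp (-‖x‖)) / 4 ≤ Real.exp (-t) * expMean (T + R) ξ (u t) := by
  set c := ε * ∫ x, g x * Real.exp (-‖x‖) with hc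
  have hc0 : 0 ≤ c := mul_nonneg hε.le (integral_nonneg_of_ae
    (hg_nonneg.mono fun x hx => mul_nonneg hx (Real.exp_pos _).le))
  set U := fun t => expMean (T + R) ξ (u t) with hU
  set V := fun t => expMean (T + R) ξ (ut t) with hV
  have hUc : ContinuousOn U (Ico 0 T) := sol.continuous_u.1.continuousOn_expMean _ ξ
  have hP : ∀ t ∈ Ico 0 T, c ≤ Real.exp (-t) * (V t + U t) := by
    intro t ht
    have := sol.planeMomentum_ge hp hε hg hf_nonneg hg_nonneg hξ.le ht
    simpa only [planeMomentum, hξ, one_mul] using this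
  have hmono : MonotoneOn (fun t => Real.exp t * U t - c / 2 * Real.exp (2 * t)) (Ico 0 T) := by
    have hd : ∀ t ∈ Ioo 0 T, HasDerivAt (fun t => Real.exp t * U t - c / 2 * Real.exp (2 * t))
        (Real.exp t * U t + Real.exp t * V t - c / 2 * (Real.exp (2 * t) * (2 * 1))) t := by
      intro t ht
      have h1 : HasDerivAt U (V t) t :=
        (sol.hasDerivWithinAt_expMean (T + R) ξ ⟨ht.1.le, ht.2⟩).hasDerivAt
          (Ico_mem_nhds ht.1 ht.2)
      exact ((Real.hasDerivAt_exp t).mul h1).sub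
        (((hasDerivAt_id' t).const_mul 2).exp.const_mul (c / 2))
    refine monotoneOn_of_deriv_nonneg (convex_Ico 0 T) (by fun_prop) ?_ ?_
    · rw [interior_Ico]
      exact fun t ht => (hd t ht).differentiableAt.differentiableWithinAt
    · rw [interior_Ico]
      intro t ht
      rw [(hd t ht).deriv]
      have h1 := hP t ⟨ht.1.le, ht.2⟩
      have h2 : Real.exp (2 * t) = Real.exp t * Real.exp t := by rw [← Real.exp_add]; ring_nf
      have h3 : Real.exp t * Real.exp (-t) = 1 := by rw [← Real.exp_add]; simp
      have h4 := mul_le_mul_of_nonneg_left h1 (Real.exp_pos (2 * t)).le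
      have h5 : Real.exp (2 * t) * (Real.exp (-t) * (V t + U t)) = Real.exp t * (V t + U t) := by
        rw [h2]
        linear_combination Real.exp t * (V t + U t) * h3
      linarith
  have h := hmono (show (0 : ℝ) ∈ Ico 0 T from ⟨le_rfl, by linarith⟩)
    (show t ∈ Ico 0 T from ⟨by linarith, htT⟩) (by linarith)
  have hU0 : 0 ≤ U 0 := sol.expMean_zero_nonneg hε hf_nonneg (T + R) ξ
  simp only [Real.exp_zero, one_mul, mul_zero] at h
  have h2 : Real.exp (2 * t) = Real.exp t * Real.exp t := by rw [← Real.exp_add]; ring_nf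
  have h3 : Real.exp (-t) * Real.exp t = 1 := by rw [← Real.exp_add]; simp
  have h4 : 2 ≤ Real.exp (2 * t) := by linarith [Real.add_one_le_exp (2 * t)]
  have h5 : c / 4 * Real.exp (2 * t) ≤ Real.exp t * U t := by nlinarith
  calc c / 4 = Real.exp (-t) * Real.exp (-t) * (c / 4 * Real.exp (2 * t)) := by
        rw [h2]
        linear_combination (-(c / 4) * (Real.exp (-t) * Real.exp t + 1)) * h3
    _ ≤ Real.exp (-t) * Real.exp (-t) * (Real.exp t * U t) :=
        mul_le_mul_of_nonneg_left h5 (by positivity)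
    _ = Real.exp (-t) * U t := by linear_combination (Real.exp (-t) * U t) * h3

end LowerBounds

/-! ### Asymptotics of the averaged exponential -/

section ExponentialMean

variable {n : ℕ}

local notation "𝔼" => EuclideanSpace ℝ (Fin n)

/-- The closed annulus `1 ≤ ‖y‖ ≤ 2`. -/
def annulus (n : ℕ) : Set (EuclideanSpace ℝ (Fin n)) :=
  {y | 1 ≤ ‖y‖ ∧ ‖y‖ ≤ 2}

theorem isCompact_annulus (n : ℕ) : IsCompact (annulus n) := by
  refine (isCompact_closedBall (0 : EuclideanSpace ℝ (Fin n)) 2).of_isClosed_subset ?_ ?_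
  · exact (isClosed_le continuous_const continuous_norm).inter
      (isClosed_le continuous_norm continuous_const)
  · intro y hy
    simpa using hy.2

theorem measurableSet_annulus (n : ℕ) : MeasurableSet (annulus n) :=
  (isCompact_annulus n).measurableSet

/-- A positive radial-type solution of `Δ Φ = Φ`: the exponentials `exp ⟪ω, x⟫`, `‖ω‖ = 1`,
averaged over the directions `ω = y / ‖y‖` of the points of an annulus. -/
noncomputable def sphereExp (x : 𝔼) : ℝ :=
  ∫ y in annulus n, Real.exp (inner ℝ (‖y‖⁻¹ • y) x)

theorem sphereExp_nonneg (x : 𝔼) : 0 ≤ sphereExp x :=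
  integral_nonneg fun _ => (Real.exp_pos _).le

theorem measurable_exp_inner_direction :
    Measurable fun z : 𝔼 × 𝔼 => Real.exp (inner ℝ (‖z.2‖⁻¹ • z.2) z.1) := by
  fun_prop

theorem stronglyMeasurable_sphereExp : StronglyMeasurable (sphereExp (n := n)) :=
  StronglyMeasurable.integral_prod_right
    (f := fun x y : 𝔼 => Real.exp (inner ℝ (‖y‖⁻¹ • y) x))
    measurable_exp_inner_direction.stronglyMeasurable

theorem norm_direction {y : 𝔼} (hy : y ∈ annulus n) : ‖‖y‖⁻¹ • y‖ = 1 := by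
  have h : 0 < ‖y‖ := by linarith [hy.1]
  rw [norm_smul, norm_inv, norm_norm, inv_mul_cancel₀ h.ne']

theorem sphereExp_le_exp (x : 𝔼) :
    sphereExp x ≤ volume.real (annulus n) * Real.exp ‖x‖ := by
  have hfin : volume (annulus n) ≠ ⊤ := (isCompact_annulus n).measure_lt_top.ne
  calc sphereExp x ≤ ∫ y in annulus n, Real.exp ‖x‖ := by
        refine integral_mono_of_nonneg (Eventually.of_forall fun _ => (Real.exp_pos _).le)
          (integrableOn_const hfin) ?_
        filter_upwards [ae_restrict_mem (measurableSet_annulus n)] with y hy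
        refine Real.exp_le_exp.2 ((real_inner_le_norm _ _).trans ?_)
        rw [norm_direction hy, one_mul]
    _ = _ := by rw [setIntegral_const, smul_eq_mul]

/-- Put `ω = y / ‖y‖` and `e = x / ‖x‖`. The left side is `-(‖x‖ / 2) ‖ω - e‖²`, and `‖y - s • e‖² ≤
2 ‖y‖² ‖ω - e‖² + 2 (s - ‖y‖)²` with `‖y‖ ≤ 2`. This is what produces `1 / 16` and `1 / 8`. -/
theorem inner_direction_sub_norm_le {x y : 𝔼} (hy : y ∈ annulus n) (hx : 0 < ‖x‖) {s : ℝ}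
    (hs : ‖x‖ * (s - ‖y‖) ^ 2 ≤ 1) :
    inner ℝ (‖y‖⁻¹ • y) x - ‖x‖ ≤ 1 / 8 - ‖x‖ / 16 * ‖y - s • (‖x‖⁻¹ • x)‖ ^ 2 := by
  set r := ‖x‖ with hr
  set ρ := ‖y‖ with hρ
  set i : ℝ := inner ℝ y x with hi
  have hρ1 : 1 ≤ ρ := hy.1
  have hρ2 : ρ ≤ 2 := hy.2
  have hir : i ≤ ρ * r := real_inner_le_norm y x
  have hsq : ∀ q : ℝ, ‖y - q • (r⁻¹ • x)‖ ^ 2 = ρ ^ 2 - 2 * q * (r⁻¹ * i) + q ^ 2 := by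
    intro q
    rw [norm_sub_sq_real, smul_smul, norm_smul, inner_smul_right, ← hi, ← hr, ← hρ, norm_mul,
      norm_inv, Real.norm_eq_abs, Real.norm_eq_abs, abs_of_pos hx, inv_mul_cancel_right₀ hx.ne',
      sq_abs]
    ring
  rw [hsq, inner_smul_left]
  simp only [conj_trivial, ← hi]
  have h2 : r * (ρ ^ 2 - 2 * s * (r⁻¹ * i) + s ^ 2) = r * (ρ ^ 2 + s ^ 2) - 2 * s * i := by
    field_simp
    ring
  have h3 : ρ⁻¹ * i = i / ρ := by ring
  have h4 : (ρ * r - i) * ρ ≤ 4 * (r - i / ρ) := by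
    rw [show r - i / ρ = (ρ * r - i) / ρ by field_simp, ← mul_div_assoc,
      le_div_iff₀ (by linarith)]
    nlinarith [mul_nonneg (sub_nonneg.2 hir) (show 0 ≤ 4 - ρ * ρ by nlinarith)]
  have h5 : r * (ρ ^ 2 + s ^ 2) - 2 * s * i ≤ 4 * ((ρ * r - i) * ρ) + 2 * (r * (s - ρ) ^ 2) := by
    -- Parallelogram law about `ρ e`: the point `(2 ρ - s) e` is the reflection of `s e`, and its
    -- squared distance to `y` is discarded.
    have h6 : r * ‖y - (2 * ρ - s) • (r⁻¹ • x)‖ ^ 2 = r * (ρ ^ 2 + (2 * ρ - s) ^ 2)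
        - 2 * (2 * ρ - s) * i := by
      rw [hsq]
      field_simp
      ring
    have h7 : 0 ≤ r * ‖y - (2 * ρ - s) • (r⁻¹ • x)‖ ^ 2 := by positivity
    rw [h6] at h7
    nlinarith
  rw [h3]
  nlinarith

theorem integral_gaussian_sub (b : ℝ) (hb : 0 < b) (v : 𝔼) :
    Integrable (fun y : 𝔼 => Real.exp (-b * ‖y - v‖ ^ 2)) ∧
    ∫ y : 𝔼, Real.exp (-b * ‖y - v‖ ^ 2) = (Real.pi / b) ^ ((n : ℝ) / 2) := by
  have h := GaussianFourier.integral_rexp_neg_mul_sq_norm (V := 𝔼) hb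
  rw [finrank_euclideanSpace_fin] at h
  have h2 := integral_sub_right_eq_self (fun y : 𝔼 => Real.exp (-b * ‖y‖ ^ 2)) v (μ := volume)
  have h3 : ∫ y : 𝔼, Real.exp (-b * ‖y - v‖ ^ 2) = (Real.pi / b) ^ ((n : ℝ) / 2) := h2.trans h
  refine ⟨by_contra fun hi => ?_, h3⟩
  rw [integral_undef hi] at h3
  exact (Real.rpow_pos_of_pos (by positivity) _).ne h3

/-- Laplace's method without surface measure. Average the Gaussian bound over `s` within `‖x‖ ^ (-1
/ 2)` of `‖y‖`; such `s` lie in `[0, 3]`. After Fubini, the full Gaussian in `y` contributes `‖x‖ ^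
(-n / 2)`, and dividing by the window length restores `‖x‖ ^ (1 / 2)`. -/
theorem sphereExp_le_of_one_le {x : 𝔼} (hx : 1 ≤ ‖x‖) :
    sphereExp x ≤ 3 / 2 * Real.exp (1 / 8) * (16 * Real.pi) ^ ((n : ℝ) / 2) *
      (Real.exp ‖x‖ * ‖x‖ ^ (-(((n : ℝ) - 1) / 2))) := by
  set r := ‖x‖ with hr
  have hr0 : 0 < r := by linarith
  set e : 𝔼 := r⁻¹ • x with he
  set b := r / 16 with hb
  have hb0 : 0 < b := by positivity
  have hs0 : 0 < √r := Real.sqrt_pos.2 hr0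
  have hs1 : 1 ≤ √r := Real.one_le_sqrt.2 hx
  have hsi : (√r)⁻¹ ≤ 1 := inv_le_one_of_one_le₀ hs1
  have hsi0 : 0 < (√r)⁻¹ := inv_pos.2 hs0
  set G : 𝔼 → ℝ → ℝ := fun y s => Real.exp (1 / 8) * Real.exp (-b * ‖y - s • e‖ ^ 2) with hG
  have hGc : Continuous fun z : 𝔼 × ℝ => G z.1 z.2 := by
    simp only [hG]
    fun_prop
  have hpt : ∀ y ∈ annulus n, 2 * (√r)⁻¹ * (Real.exp (-r) * Real.exp (inner ℝ (‖y‖⁻¹ • y) x))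
      ≤ ∫ s in Icc (0 : ℝ) 3, G y s := by
    intro y hy
    have hGi : IntegrableOn (G y) (Icc 0 3) :=
      (hGc.comp (Continuous.prodMk_right y)).continuousOn.integrableOn_compact isCompact_Icc
    have hsub : Icc (‖y‖ - (√r)⁻¹) (‖y‖ + (√r)⁻¹) ⊆ Icc (0 : ℝ) 3 := fun s hs =>
      ⟨by linarith [hs.1, hy.1], by linarith [hs.2, hy.2]⟩
    calc 2 * (√r)⁻¹ * (Real.exp (-r) * Real.exp (inner ℝ (‖y‖⁻¹ • y) x))
        = ∫ s in Icc (‖y‖ - (√r)⁻¹) (‖y‖ + (√r)⁻¹),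
            Real.exp (-r) * Real.exp (inner ℝ (‖y‖⁻¹ • y) x) := by
          rw [setIntegral_const, Real.volume_real_Icc_of_le (by linarith), smul_eq_mul]
          ring
      _ ≤ ∫ s in Icc (‖y‖ - (√r)⁻¹) (‖y‖ + (√r)⁻¹), G y s := by
          refine setIntegral_mono_on (integrableOn_const (by simp)) (hGi.mono_set hsub)
            measurableSet_Icc fun s hs => ?_
          simp only [hG]
          rw [← Real.exp_add, ← Real.exp_add]
          refine Real.exp_le_exp.2 ?_
          have h1 : r * (s - ‖y‖) ^ 2 ≤ 1 := by
            have h2 : |s - ‖y‖| ≤ (√r)⁻¹ := abs_le.2 ⟨by linarith [hs.1], by linarith [hs.2]⟩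
            have h3 : (s - ‖y‖) ^ 2 ≤ ((√r)⁻¹) ^ 2 := sq_le_sq' (abs_le.1 h2).1 (abs_le.1 h2).2
            calc r * (s - ‖y‖) ^ 2 ≤ r * ((√r)⁻¹) ^ 2 := by gcongr
              _ = 1 := by rw [inv_pow, Real.sq_sqrt hr0.le, mul_inv_cancel₀ hr0.ne']
          have := inner_direction_sub_norm_le hy hr0 h1
          rw [← hr, ← he] at this
          rw [hb]
          linarith
      _ ≤ ∫ s in Icc (0 : ℝ) 3, G y s :=
          setIntegral_mono_set hGi (Eventually.of_forall fun s => by positivity)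
            (LE.le.eventuallyLE hsub)
  have hprod : Integrable (Function.uncurry G)
      ((volume.restrict (annulus n)).prod (volume.restrict (Icc (0 : ℝ) 3))) := by
    rw [Measure.prod_restrict]
    exact hGc.continuousOn.integrableOn_compact ((isCompact_annulus n).prod isCompact_Icc)
  have hA : 2 * (√r)⁻¹ * (Real.exp (-r) * sphereExp x)
      ≤ ∫ y in annulus n, ∫ s in Icc (0 : ℝ) 3, G y s := by
    rw [sphereExp, ← integral_const_mul, ← integral_const_mul]
    refine integral_mono_of_nonneg (Eventually.of_forall fun _ => by positivity)
      hprod.integral_prod_left ?_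
    filter_upwards [ae_restrict_mem (measurableSet_annulus n)] with y hy using hpt y hy
  have hB : ∫ y in annulus n, ∫ s in Icc (0 : ℝ) 3, G y s
      ≤ 3 * (Real.exp (1 / 8) * (Real.pi / b) ^ ((n : ℝ) / 2)) := by
    rw [integral_integral_swap hprod]
    calc ∫ s in Icc (0 : ℝ) 3, ∫ y in annulus n, G y s
        ≤ ∫ s in Icc (0 : ℝ) 3, Real.exp (1 / 8) * (Real.pi / b) ^ ((n : ℝ) / 2) := by
          refine integral_mono_of_nonneg
            (Eventually.of_forall fun _ => integral_nonneg fun _ => by positivity)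
            (integrableOn_const (by simp)) (Eventually.of_forall fun s => ?_)
          obtain ⟨h1, h2⟩ := integral_gaussian_sub b hb0 (s • e)
          simp only [hG]
          rw [integral_const_mul, ← h2]
          exact mul_le_mul_of_nonneg_left
            (setIntegral_le_integral h1 (Eventually.of_forall fun _ => (Real.exp_pos _).le))
            (Real.exp_pos _).le
      _ = _ := by
          rw [setIntegral_const, Real.volume_real_Icc_of_le (by norm_num), smul_eq_mul]
          ring
  have hC := hA.trans hB
  have h1 : Real.pi / b = 16 * Real.pi / r := by rw [hb]; field_simp
  have h2 : (Real.pi / b) ^ ((n : ℝ) / 2) = (16 * Real.pi) ^ ((n : ℝ) / 2) * r ^ (-((n : ℝ) / 2)) := by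
    rw [h1, Real.div_rpow (by positivity) hr0.le, Real.rpow_neg hr0.le, div_eq_mul_inv]
  have h3 : r ^ (-(((n : ℝ) - 1) / 2)) = √r * r ^ (-((n : ℝ) / 2)) := by
    rw [Real.sqrt_eq_rpow, ← Real.rpow_add hr0]
    congr 1
    ring
  rw [h2] at hC
  rw [h3]
  have h4 : Real.exp r * Real.exp (-r) = 1 := by rw [← Real.exp_add]; simp
  have h5 : √r * (√r)⁻¹ = 1 := mul_inv_cancel₀ hs0.ne'
  calc sphereExp x = √r * Real.exp r / 2 * (2 * (√r)⁻¹ * (Real.exp (-r) * sphereExp x)) := by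
        linear_combination (-sphereExp x * (√r * (√r)⁻¹)) * h4 - sphereExp x * h5
    _ ≤ √r * Real.exp r / 2 * (3 * (Real.exp (1 / 8) *
        ((16 * Real.pi) ^ ((n : ℝ) / 2) * r ^ (-((n : ℝ) / 2))))) := by gcongr
    _ = _ := by ring

theorem exists_sphereExp_le (hn : 1 ≤ n) : ∃ C : ℝ, 0 < C ∧ ∀ x : 𝔼,
    sphereExp x ≤ C * (Real.exp ‖x‖ * (1 + ‖x‖) ^ (-(((n : ℝ) - 1) / 2))) := by
  have hn' : (1 : ℝ) ≤ n := by exact_mod_cast hn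
  set a := ((n : ℝ) - 1) / 2 with ha
  have ha0 : 0 ≤ a := by rw [ha]; linarith
  set C₁ := 3 / 2 * Real.exp (1 / 8) * (16 * Real.pi) ^ ((n : ℝ) / 2) with hC₁
  have hC₁0 : 0 < C₁ := by positivity
  refine ⟨(C₁ + volume.real (annulus n)) * 2 ^ a, by positivity, fun x => ?_⟩
  set r := ‖x‖ with hr
  have hr0 : 0 ≤ r := norm_nonneg x
  have key : ∀ q : ℝ, 0 < q → 1 + r ≤ 2 * q → q ^ (-a) ≤ 2 ^ a * (1 + r) ^ (-a) := by
    intro q hq h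
    calc q ^ (-a) = 2 ^ a * (2 * q) ^ (-a) := by
          rw [Real.mul_rpow (by norm_num) hq.le, ← mul_assoc, ← Real.rpow_add (by norm_num)]
          simp
      _ ≤ 2 ^ a * (1 + r) ^ (-a) := by
          refine mul_le_mul_of_nonneg_left ?_ (by positivity)
          exact Real.rpow_le_rpow_of_nonpos (by positivity) h (by linarith)
  have hv : 0 ≤ volume.real (annulus n) := measureReal_nonneg
  rcases le_total 1 r with h | h
  · calc sphereExp x ≤ C₁ * (Real.exp r * r ^ (-a)) := sphereExp_le_of_one_le h
      _ ≤ (C₁ + volume.real (annulus n)) * (Real.exp r * (2 ^ a * (1 + r) ^ (-a))) := by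
          have := key r (by linarith) (by linarith)
          gcongr
          linarith
      _ = _ := by ring
  · calc sphereExp x ≤ volume.real (annulus n) * Real.exp r := sphereExp_le_exp x
      _ = volume.real (annulus n) * (Real.exp r * 1 ^ (-a)) := by simp
      _ ≤ (C₁ + volume.real (annulus n)) * (Real.exp r * (2 ^ a * (1 + r) ^ (-a))) := by
          have := key 1 one_pos (by linarith)
          gcongr
          linarith
      _ = _ := by ring

end ExponentialMean

/-! ### Integrals of powers of the averaged exponential -/

section RadialIntegral

variable {n : ℕ}

local notation "𝔼" => EuclideanSpace ℝ (Fin n)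

/-- In polar coordinates the weight concentrates in a shell of width `1 / δ` at the boundary, hence
a surface power of `L` instead of a volume power. -/
theorem setIntegral_exp_norm_sub_le (hn : 1 ≤ n) {L δ : ℝ} (hL : 0 < L) (hδ : 0 < δ) :
    ∫ x in Metric.closedBall (0 : 𝔼) L, Real.exp (-(δ * (L - ‖x‖)))
      ≤ n * volume.real (Metric.ball (0 : 𝔼) 1) / δ * L ^ (n - 1) := by
  have : Nonempty (Fin n) := ⟨⟨0, hn⟩⟩
  set F : ℝ → ℝ := (Iic L).indicator fun y => Real.exp (-(δ * (L - y))) with hF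
  have h1 : ∫ x in Metric.closedBall (0 : 𝔼) L, Real.exp (-(δ * (L - ‖x‖)))
      = ∫ x : 𝔼, F ‖x‖ := by
    rw [← integral_indicator Metric.isClosed_closedBall.measurableSet]
    congr 1
    ext x
    by_cases h : ‖x‖ ≤ L <;> simp [hF, indicator, h]
  rw [h1, integral_fun_norm_addHaar volume F, finrank_euclideanSpace_fin, nsmul_eq_mul,
    smul_eq_mul]
  have h2 : ∫ y in Ioi (0 : ℝ), y ^ (n - 1) • F y
      = ∫ y in (0 : ℝ)..L, y ^ (n - 1) * Real.exp (-(δ * (L - y))) := by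
    rw [intervalIntegral.integral_of_le hL.le, ← Ioi_inter_Iic,
      ← setIntegral_indicator measurableSet_Iic]
    refine integral_congr_ae (Eventually.of_forall fun y => ?_)
    by_cases h : y ≤ L <;> simp [hF, indicator, h]
  have hd : ∀ y : ℝ, HasDerivAt (fun y => Real.exp (-(δ * (L - y))) / δ)
      (Real.exp (-(δ * (L - y)))) y := by
    intro y
    have := (((hasDerivAt_id' y).const_sub L).const_mul δ).fun_neg.exp.div_const δ
    refine this.congr_deriv ?_
    field_simp
  have h3 : ∫ y in (0 : ℝ)..L, y ^ (n - 1) * Real.exp (-(δ * (L - y)))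
      ≤ L ^ (n - 1) * (1 / δ) := by
    calc ∫ y in (0 : ℝ)..L, y ^ (n - 1) * Real.exp (-(δ * (L - y)))
        ≤ ∫ y in (0 : ℝ)..L, L ^ (n - 1) * Real.exp (-(δ * (L - y))) := by
          refine intervalIntegral.integral_mono_on hL.le
            (Continuous.intervalIntegrable (by fun_prop) _ _)
            (Continuous.intervalIntegrable (by fun_prop) _ _) fun y hy => ?_
          exact mul_le_mul_of_nonneg_right (pow_le_pow_left₀ hy.1 hy.2 _) (Real.exp_pos _).le
      _ = L ^ (n - 1) * (1 / δ - Real.exp (-(δ * L)) / δ) := by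
          rw [intervalIntegral.integral_const_mul,
            intervalIntegral.integral_eq_sub_of_hasDerivAt (fun y _ => hd y)
              (Continuous.intervalIntegrable (by fun_prop) _ _)]
          simp
      _ ≤ L ^ (n - 1) * (1 / δ) := by
          have : 0 ≤ Real.exp (-(δ * L)) / δ := by positivity
          gcongr
          linarith
  rw [h2]
  calc (n : ℝ) * (volume.real (Metric.ball (0 : 𝔼) 1) * _)
      ≤ n * (volume.real (Metric.ball (0 : 𝔼) 1) * (L ^ (n - 1) * (1 / δ))) := by gcongr
    _ = _ := by ring

/-- With `z = t + R - ‖x‖`, the integrand decays like `exp (-q z)` away from the boundary. Half of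
this decay pays for replacing `1 + ‖x‖` by `1 + t` in the polynomial factor; the other half is
integrated over the shell. -/
theorem exists_integral_sphereExp_rpow_le (hn : 2 ≤ n) {q R : ℝ} (hq : 0 < q) (hR : 1 ≤ R) :
    ∃ C : ℝ, 0 < C ∧ ∀ t : ℝ, 0 ≤ t →
      ∫ x in Metric.closedBall (0 : 𝔼) (t + R), (Real.exp (-t) * sphereExp x) ^ q
        ≤ C * (1 + t) ^ (((n : ℝ) - 1) * (1 - q / 2)) := by
  obtain ⟨C, hC, hb⟩ := exists_sphereExp_le (n := n) (by omega)
  have hn' : (2 : ℝ) ≤ n := by exact_mod_cast hn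
  have hn1 : (0 : ℝ) < n - 1 := by linarith
  set σ : ℝ := ((n : ℝ) - 1) / 2 * q with hσ
  have hσ0 : 0 < σ := by positivity
  set V : ℝ := volume.real (Metric.ball (0 : 𝔼) 1) with hV
  have hV0 : 0 < V :=
    ENNReal.toReal_pos (Metric.measure_ball_pos volume _ one_pos).ne' measure_ball_lt_top.ne
  refine ⟨C ^ q * (n : ℝ) ^ σ * Real.exp (q * R) * (n * V / (q / 2)) * R ^ (n - 1), by positivity,
    fun t ht => ?_⟩
  set L := t + R with hL
  have hL0 : 0 < L := by linarith
  have hpt : ∀ x ∈ Metric.closedBall (0 : 𝔼) L, (Real.exp (-t) * sphereExp x) ^ q ≤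
      C ^ q * (n : ℝ) ^ σ * Real.exp (q * R) * (1 + t) ^ (-σ)
        * Real.exp (-(q / 2 * (L - ‖x‖))) := by
    intro x hx
    have hxL : ‖x‖ ≤ L := by simpa using hx
    set r := ‖x‖ with hr
    have hr0 : 0 ≤ r := norm_nonneg x
    set z := L - r with hz
    have hz0 : 0 ≤ z := by linarith
    -- The rate `1 / (n - 1)` is chosen so that the power `σ` turns it into exactly `q / 2`.
    have h1 : 1 + z ≤ n * Real.exp (z / (n - 1)) := by
      have := Real.add_one_le_exp (z / ((n : ℝ) - 1))
      have h2 : z = ((n : ℝ) - 1) * (z / (n - 1)) := by field_simp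
      have h3 : 0 ≤ z / ((n : ℝ) - 1) := by positivity
      nlinarith
    have h2 : (1 + z) ^ σ ≤ (n : ℝ) ^ σ * Real.exp (q / 2 * z) := by
      calc (1 + z) ^ σ ≤ (n * Real.exp (z / (n - 1))) ^ σ := by gcongr
        _ = _ := by
          rw [Real.mul_rpow (by positivity) (Real.exp_pos _).le, ← Real.exp_mul, hσ]
          congr 2
          field_simp
    have h3 : (1 + t) ^ σ ≤ (1 + r) ^ σ * ((n : ℝ) ^ σ * Real.exp (q / 2 * z)) := by
      calc (1 + t) ^ σ ≤ ((1 + r) * (1 + z)) ^ σ := by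
            gcongr
            nlinarith
        _ = (1 + r) ^ σ * (1 + z) ^ σ := Real.mul_rpow (by positivity) (by positivity)
        _ ≤ _ := by gcongr
    have h4 : (1 + r) ^ (-σ) ≤ (1 + t) ^ (-σ) * ((n : ℝ) ^ σ * Real.exp (q / 2 * z)) := by
      rw [Real.rpow_neg (by positivity), Real.rpow_neg (by positivity), ← div_eq_inv_mul,
        inv_eq_one_div, div_le_div_iff₀ (by positivity) (by positivity)]
      linarith
    calc (Real.exp (-t) * sphereExp x) ^ q
        ≤ (Real.exp (-t) * (C * (Real.exp r * (1 + r) ^ (-(((n : ℝ) - 1) / 2))))) ^ q := by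
          refine Real.rpow_le_rpow (mul_nonneg (Real.exp_pos _).le (sphereExp_nonneg x)) ?_ hq.le
          exact mul_le_mul_of_nonneg_left (hb x) (Real.exp_pos _).le
      _ = C ^ q * Real.exp (q * (r - t)) * (1 + r) ^ (-σ) := by
          rw [Real.mul_rpow (by positivity) (by positivity),
            Real.mul_rpow (by positivity) (by positivity),
            Real.mul_rpow (by positivity) (by positivity), ← Real.exp_mul, ← Real.exp_mul,
            ← Real.rpow_mul (by positivity),
            show q * (r - t) = -t * q + r * q by ring, Real.exp_add,
            show -(((n : ℝ) - 1) / 2) * q = -σ by rw [hσ]; ring]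
          ring
      _ ≤ C ^ q * Real.exp (q * (r - t)) *
            ((1 + t) ^ (-σ) * ((n : ℝ) ^ σ * Real.exp (q / 2 * z))) := by gcongr
      _ = _ := by
          have : Real.exp (q * (r - t)) * Real.exp (q / 2 * z)
              = Real.exp (q * R) * Real.exp (-(q / 2 * z)) := by
            rw [← Real.exp_add, ← Real.exp_add]
            congr 1
            rw [hz, hL]
            ring
          linear_combination C ^ q * (1 + t) ^ (-σ) * (n : ℝ) ^ σ * this
  calc ∫ x in Metric.closedBall (0 : 𝔼) L, (Real.exp (-t) * sphereExp x) ^ q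
      ≤ ∫ x in Metric.closedBall (0 : 𝔼) L, C ^ q * (n : ℝ) ^ σ * Real.exp (q * R) *
          (1 + t) ^ (-σ) * Real.exp (-(q / 2 * (L - ‖x‖))) := by
        refine integral_mono_of_nonneg (Eventually.of_forall fun x => ?_) ?_ ?_
        · exact Real.rpow_nonneg (mul_nonneg (Real.exp_pos _).le (sphereExp_nonneg x)) _
        · exact ContinuousOn.integrableOn_compact (isCompact_closedBall _ _) (by fun_prop)
        · filter_upwards [ae_restrict_mem Metric.isClosed_closedBall.measurableSet] with x hx
            using hpt x hx
    _ ≤ C ^ q * (n : ℝ) ^ σ * Real.exp (q * R) * (1 + t) ^ (-σ) *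
          (n * V / (q / 2) * L ^ (n - 1)) := by
        rw [integral_const_mul]
        exact mul_le_mul_of_nonneg_left
          (setIntegral_exp_norm_sub_le (by omega) hL0 (by positivity)) (by positivity)
    _ ≤ C ^ q * (n : ℝ) ^ σ * Real.exp (q * R) * (1 + t) ^ (-σ) *
          (n * V / (q / 2) * (R * (1 + t)) ^ (n - 1)) := by
        have : L ≤ R * (1 + t) := by rw [hL]; nlinarith
        gcongr
    _ = _ := by
        have h1 : (1 + t) ^ (((n : ℝ) - 1) * (1 - q / 2)) = (1 + t) ^ (-σ) * (1 + t) ^ (n - 1) := by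
          rw [← Real.rpow_natCast, ← Real.rpow_add (by positivity), Nat.cast_sub (by omega), hσ]
          congr 1
          push_cast
          ring
        rw [h1, mul_pow]
        ring

end RadialIntegral

/-! ### Two lower bounds for the nonlinear term -/

section Hoelder

variable {n : ℕ}

local notation "𝔼" => EuclideanSpace ℝ (Fin n)

theorem annulus_volume_pos (hn : 1 ≤ n) : 0 < volume.real (annulus n) := by
  have : Nonempty (Fin n) := ⟨⟨0, hn⟩⟩
  refine ENNReal.toReal_pos ?_ (isCompact_annulus n).measure_lt_top.ne
  have hopen : IsOpen {y : 𝔼 | 1 < ‖y‖ ∧ ‖y‖ < 2} :=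
    (isOpen_lt continuous_const continuous_norm).inter (isOpen_lt continuous_norm continuous_const)
  obtain ⟨e, he⟩ := exists_norm_eq 𝔼 (show (0 : ℝ) ≤ 3 / 2 by norm_num)
  have hne : {y : 𝔼 | 1 < ‖y‖ ∧ ‖y‖ < 2}.Nonempty := ⟨e, by
    constructor <;> rw [he] <;> norm_num⟩
  exact ((hopen.measure_pos volume hne).trans_le
    (measure_mono (show _ ⊆ annulus n from fun y hy => ⟨hy.1.le, hy.2.le⟩))).ne'

theorem rpow_mul_rpow_le_of_le {p X G J J' : ℝ} (hp : 1 < p) (hX : 0 ≤ X) (hG : 0 ≤ G)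
    (hJ : 0 ≤ J) (hJ' : 0 < J') (hJJ : J ≤ J')
    (h : X ≤ G ^ (1 / p) * J ^ (1 / (p / (p - 1)))) :
    X ^ p * J' ^ (-(p - 1)) ≤ G := by
  have hp0 : 0 < p := by linarith
  have hp1 : 0 < p - 1 := by linarith
  have h1 : X ^ p ≤ G * J' ^ (p - 1) := by
    calc X ^ p ≤ (G ^ (1 / p) * J ^ (1 / (p / (p - 1)))) ^ p := by gcongr
      _ = G * J ^ (p - 1) := by
        rw [Real.mul_rpow (by positivity) (by positivity), ← Real.rpow_mul hG, ← Real.rpow_mul hJ]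
        congr 1
        · rw [one_div_mul_cancel hp0.ne', Real.rpow_one]
        · congr 1
          field_simp
      _ ≤ G * J' ^ (p - 1) := by gcongr
  rw [Real.rpow_neg hJ'.le, ← div_eq_mul_inv, div_le_iff₀ (by positivity)]
  exact h1

theorem setIntegral_mul_le_of_integrable_rpow {p : ℝ} (hp : 1 < p) {r : ℝ} {v w : 𝔼 → ℝ}
    (hv : AEStronglyMeasurable v) (hvp : Integrable fun x => |v x| ^ p)
    (hw : StronglyMeasurable w) (hw0 : ∀ x, 0 ≤ w x) {M : ℝ}
    (hM : ∀ x ∈ Metric.closedBall (0 : 𝔼) r, w x ≤ M) :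
    ∫ x in Metric.closedBall 0 r, v x * w x
      ≤ (∫ x in Metric.closedBall 0 r, |v x| ^ p) ^ (1 / p)
        * (∫ x in Metric.closedBall 0 r, w x ^ (p / (p - 1))) ^ (1 / (p / (p - 1))) := by
  have hpq : p.HolderConjugate (p / (p - 1)) := Real.HolderConjugate.conjExponent hp
  have hfin : IsFiniteMeasure (volume.restrict (Metric.closedBall (0 : 𝔼) r)) :=
    ⟨by simpa using (isCompact_closedBall (0 : 𝔼) r).measure_lt_top⟩
  have hwM : MemLp w ⊤ (volume.restrict (Metric.closedBall (0 : 𝔼) r)) := by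
    refine memLp_top_of_bound hw.aestronglyMeasurable M ?_
    filter_upwards [ae_restrict_mem Metric.isClosed_closedBall.measurableSet] with x hx
    rw [Real.norm_eq_abs, abs_of_nonneg (hw0 x)]
    exact hM x hx
  have hvL : MemLp (fun x => |v x|) (ENNReal.ofReal p)
      (volume.restrict (Metric.closedBall (0 : 𝔼) r)) := by
    have h1 : MemLp v (ENNReal.ofReal p) := by
      rw [← integrable_norm_rpow_iff hv (by simpa using by linarith) ENNReal.ofReal_ne_top,
        ENNReal.toReal_ofReal (by linarith)]
      exact hvp
    exact (h1.restrict _).abs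
  have h2 := integral_mul_le_Lp_mul_Lq_of_nonneg
    (μ := volume.restrict (Metric.closedBall (0 : 𝔼) r)) hpq
    (Eventually.of_forall fun x => abs_nonneg (v x)) (Eventually.of_forall hw0) hvL
    (hwM.mono_exponent le_top)
  refine ((le_abs_self _).trans abs_integral_le_integral_abs).trans (le_of_eq_of_le ?_ h2)
  simp only [abs_mul, abs_of_nonneg (hw0 _)]

theorem integral_annulus_expMean {v : 𝔼 → ℝ} (hv : MemLp v 2) (r : ℝ) :
    IntegrableOn (fun y => expMean r (‖y‖⁻¹ • y) v) (annulus n) ∧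
    ∫ y in annulus n, expMean r (‖y‖⁻¹ • y) v
      = ∫ x in Metric.closedBall 0 r, v x * sphereExp x := by
  have hfin : IsFiniteMeasure (volume.restrict (annulus n)) :=
    ⟨by simpa using (isCompact_annulus n).measure_lt_top⟩
  have hvi : IntegrableOn v (Metric.closedBall 0 r) := by
    simpa using integrableOn_mul_exp_inner hv r 0
  have hI : Integrable (Function.uncurry fun y x : 𝔼 =>
      v x * Real.exp (inner ℝ (‖y‖⁻¹ • y) x))
      ((volume.restrict (annulus n)).prod (volume.restrict (Metric.closedBall 0 r))) := by
    refine (hvi.comp_snd _).mul_bdd (c := Real.exp r) ?_ ?_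
    · exact (by fun_prop : Measurable fun z : 𝔼 × 𝔼 =>
        Real.exp (inner ℝ (‖z.1‖⁻¹ • z.1) z.2)).aestronglyMeasurable
    · rw [Measure.prod_restrict]
      filter_upwards [ae_restrict_mem ((measurableSet_annulus n).prod
        Metric.isClosed_closedBall.measurableSet)] with z hz
      rw [Real.norm_eq_abs, Real.abs_exp]
      refine Real.exp_le_exp.2 ((real_inner_le_norm _ _).trans ?_)
      rw [norm_direction hz.1, one_mul]
      simpa using hz.2
  refine ⟨hI.integral_prod_left, ?_⟩
  simp only [expMean, sphereExp, ← integral_const_mul]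
  exact integral_integral_swap hI

variable {p R ε T : ℝ} {f g : EuclideanSpace ℝ (Fin n) → ℝ}
  {u ut : ℝ → EuclideanSpace ℝ (Fin n) → ℝ}

theorem setIntegral_closedBall_eq_of_support {r r' : ℝ} (hr : r ≤ r') {v : 𝔼 → ℝ}
    (hv : ∀ᵐ x, r < ‖x‖ → v x = 0) (w : 𝔼 → ℝ) :
    ∫ x in Metric.closedBall 0 r', v x * w x = ∫ x in Metric.closedBall 0 r, v x * w x := by
  rw [← integral_eq_setIntegral_closedBall hv fun _ _ => rfl,
    ← integral_eq_setIntegral_closedBall (w := w) (k := w) _ fun _ _ => rfl]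
  filter_upwards [hv] with x hx h using hx (hr.trans_lt h)

theorem IsSolution.setIntegral_rpow_eq (sol : IsSolution p f g R ε T u ut) (hp : 0 < p) {t : ℝ}
    (ht : t ∈ Ico 0 T) :
    ∫ x in Metric.closedBall 0 (t + R), |u t x| ^ p
      = expMean (T + R) 0 fun x => |u t x| ^ p := by
  have h : ∀ᵐ x, t + R < ‖x‖ → |u t x| ^ p = 0 := by
    filter_upwards [sol.support_u t ht] with x hx h
    rw [hx h, abs_zero, Real.zero_rpow hp.ne']
  have := setIntegral_closedBall_eq_of_support (by linarith [ht.2] : t + R ≤ T + R) h fun _ => 1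
  simp only [mul_one] at this
  simp only [expMean, inner_zero_left, Real.exp_zero, mul_one, this]

/-- Average the linear lower bound over directions and apply Hölder with weight `exp (-t) *
sphereExp x`. The conjugate exponent `q = p / (p - 1)` gives `-(p - 1) (1 - q / 2) = 1 - p / 2`. -/
theorem exists_integral_rpow_ge_data (hn : 2 ≤ n) (hp : 1 < p) (hR : 1 ≤ R) {g : 𝔼 → ℝ}
    (hg : MemLp g 2) (hg_nonneg : ∀ᵐ x, 0 ≤ g x)
    (hg_pos : 0 < ∫ x, g x * Real.exp (-‖x‖)) :
    ∃ c : ℝ, 0 < c ∧ ∀ (f : 𝔼 → ℝ) (ε T : ℝ) (u ut : ℝ → 𝔼 → ℝ),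
      (∀ᵐ x, 0 ≤ f x) → 0 < ε → IsSolution p f g R ε T u ut → ∀ t, 1 ≤ t → t < T →
      (Integrable fun x => |u t x| ^ p) →
      c * ε ^ p * (1 + t) ^ (((n : ℝ) - 1) * (1 - p / 2))
        ≤ expMean (T + R) 0 fun x => |u t x| ^ p := by
  have hp1 : 0 < p - 1 := by linarith
  have hp0 : 0 < p := by linarith
  obtain ⟨C, hC, hCI⟩ := exists_integral_sphereExp_rpow_le hn (q := p / (p - 1)) (by positivity) hR
  set a := (∫ x, g x * Real.exp (-‖x‖)) / 4 * volume.real (annulus n) with ha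
  have ha0 : 0 < a := mul_pos (by linarith) (annulus_volume_pos (by omega))
  refine ⟨a ^ p * C ^ (-(p - 1)), by positivity, ?_⟩
  intro f ε T u ut hf_nonneg hε sol t ht1 htT hint
  have htI : t ∈ Ico 0 T := ⟨by linarith, htT⟩
  have hu2 : MemLp (u t) 2 := sol.continuous_u.1.1 t htI
  obtain ⟨hi, heq⟩ := integral_annulus_expMean hu2 (T + R)
  have h1 : ε * a ≤ ∫ x in Metric.closedBall 0 (t + R), u t x * (Real.exp (-t) * sphereExp x) := by
    rw [← setIntegral_closedBall_eq_of_support (by linarith : t + R ≤ T + R)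
      (sol.support_u t htI)]
    simp only [mul_left_comm (u t _)]
    rw [integral_const_mul, ← heq, ← integral_const_mul]
    calc ε * a = ∫ y in annulus n, ε * (∫ x, g x * Real.exp (-‖x‖)) / 4 := by
          rw [setIntegral_const, smul_eq_mul, ha]
          ring
      _ ≤ _ := by
          refine setIntegral_mono_on (integrableOn_const (isCompact_annulus n).measure_lt_top.ne)
            (hi.const_mul _) (measurableSet_annulus n) fun y hy => ?_
          exact sol.expMean_ge hp0 hε hg hf_nonneg hg_nonneg (norm_direction hy) ht1 htT
  have hw0 : ∀ x : 𝔼, 0 ≤ Real.exp (-t) * sphereExp x := fun x =>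
    mul_nonneg (Real.exp_pos _).le (sphereExp_nonneg x)
  have h2 := setIntegral_mul_le_of_integrable_rpow hp (r := t + R) hu2.1 hint
    (w := fun x => Real.exp (-t) * sphereExp x)
    (stronglyMeasurable_sphereExp.const_mul _) hw0
    (M := Real.exp (-t) * (volume.real (annulus n) * Real.exp (t + R))) (by
      intro x hx
      have hx' : ‖x‖ ≤ t + R := by simpa using hx
      have hv : 0 ≤ volume.real (annulus n) := measureReal_nonneg
      have := sphereExp_le_exp x
      refine mul_le_mul_of_nonneg_left (this.trans ?_) (Real.exp_pos _).le
      gcongr)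
  have h3 := rpow_mul_rpow_le_of_le hp (by positivity : 0 ≤ ε * a)
    (integral_nonneg fun x => Real.rpow_nonneg (abs_nonneg _) _)
    (integral_nonneg fun x => Real.rpow_nonneg (hw0 x) _)
    (by positivity) (hCI t htI.1) (h1.trans h2)
  rw [sol.setIntegral_rpow_eq hp0 htI] at h3
  refine le_of_eq_of_le ?_ h3
  have h4 : 0 < 1 + t := by linarith
  rw [Real.mul_rpow hε.le ha0.le, Real.mul_rpow hC.le (by positivity), ← Real.rpow_mul h4.le,
    show ((n : ℝ) - 1) * (1 - p / (p - 1) / 2) * -(p - 1) = ((n : ℝ) - 1) * (1 - p / 2) by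
      field_simp; ring]
  ring

/-- Hölder against the constant 1 on the ball of radius `t + R`, whose volume is proportional to `(t
+ R) ^ n`. -/
theorem exists_integral_rpow_ge_mean (hn : 1 ≤ n) (hp : 1 < p) (hR : 1 ≤ R) :
    ∃ c : ℝ, 0 < c ∧ ∀ (f g : 𝔼 → ℝ) (ε T : ℝ) (u ut : ℝ → 𝔼 → ℝ),
      IsSolution p f g R ε T u ut → ∀ t, 0 ≤ t → t < T → 0 ≤ expMean (T + R) 0 (u t) →
      (Integrable fun x => |u t x| ^ p) →
      c * (t + R) ^ (-(n * (p - 1))) * expMean (T + R) 0 (u t) ^ p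
        ≤ expMean (T + R) 0 fun x => |u t x| ^ p := by
  have hp1 : 0 < p - 1 := by linarith
  have hp0 : 0 < p := by linarith
  have : Nonempty (Fin n) := ⟨⟨0, hn⟩⟩
  set V : ℝ := volume.real (Metric.ball (0 : 𝔼) 1) with hV
  have hV0 : 0 < V :=
    ENNReal.toReal_pos (Metric.measure_ball_pos volume _ one_pos).ne' measure_ball_lt_top.ne
  refine ⟨V ^ (-(p - 1)), by positivity, ?_⟩
  intro f g ε T u ut sol t ht0 htT hU hint
  have htI : t ∈ Ico 0 T := ⟨ht0, htT⟩
  have hL : 0 < t + R := by linarith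
  have hu2 : MemLp (u t) 2 := sol.continuous_u.1.1 t htI
  have h1 : expMean (T + R) 0 (u t) = ∫ x in Metric.closedBall 0 (t + R), u t x * 1 := by
    rw [← setIntegral_closedBall_eq_of_support (by linarith : t + R ≤ T + R)
      (sol.support_u t htI)]
    simp only [expMean, inner_zero_left, Real.exp_zero]
  have h2 := setIntegral_mul_le_of_integrable_rpow hp (r := t + R) hu2.1 hint
    (w := fun _ => 1) stronglyMeasurable_const (fun _ => zero_le_one) (M := 1) fun _ _ => le_rfl
  have hvol : ∫ x in Metric.closedBall (0 : 𝔼) (t + R), (1 : ℝ) ^ (p / (p - 1))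
      = (t + R) ^ n * V := by
    rw [setIntegral_const, Real.one_rpow, smul_eq_mul, mul_one, measureReal_def,
      Measure.addHaar_closedBall _ _ hL.le, ENNReal.toReal_mul,
      ENNReal.toReal_ofReal (by positivity), finrank_euclideanSpace_fin]
    rfl
  rw [h1] at hU ⊢
  have h3 := rpow_mul_rpow_le_of_le hp hU
    (integral_nonneg fun x => Real.rpow_nonneg (abs_nonneg _) _)
    (integral_nonneg fun x => Real.rpow_nonneg zero_le_one _)
    (by positivity) hvol.le h2
  rw [sol.setIntegral_rpow_eq hp0 htI] at h3
  refine le_of_eq_of_le ?_ h3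
  rw [Real.mul_rpow (by positivity) hV0.le, ← Real.rpow_natCast, ← Real.rpow_mul hL.le, mul_neg]
  ring

end Hoelder

/-! ### Blow-up for the ordinary differential inequality -/

section Blowup

theorem add_sq_le_of_increment {T s t₀ m : ℝ} {U V : ℝ → ℝ} (hs : 0 ≤ s) (ht₀ : t₀ ≤ T)
    (hU : ∀ t ∈ Ico 0 T, HasDerivWithinAt U (V t) (Ico 0 T) t) (hV : ∀ t ∈ Ico 0 T, 0 ≤ V t)
    (hm : ∀ t ∈ Ico s t₀, m * (t - s) ≤ V t - V s) {t : ℝ} (ht : t ∈ Ico s t₀) :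
    U s + m * (t - s) ^ 2 / 2 ≤ U t := by
  have hsub : Ico s t₀ ⊆ Ico 0 T := Ico_subset_Ico hs ht₀
  have hd : ∀ r ∈ Ioo s t₀, HasDerivAt (fun r => U r - m * (r - s) ^ 2 / 2)
      (V r - m * (r - s)) r := by
    intro r hr
    have h1 : HasDerivAt U (V r) r := (hU r (hsub ⟨hr.1.le, hr.2⟩)).hasDerivAt
      (Ico_mem_nhds (hs.trans_lt hr.1) (hr.2.trans_le ht₀))
    refine (h1.sub (((((hasDerivAt_id' r).sub_const s).pow 2).const_mul m).div_const 2)).congr_deriv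
      ?_
    simp
    ring
  have hUc : ContinuousOn U (Ico s t₀) :=
    fun r hr => ((hU r (hsub hr)).continuousWithinAt).mono hsub
  have hmono : MonotoneOn (fun r => U r - m * (r - s) ^ 2 / 2) (Ico s t₀) := by
    refine monotoneOn_of_deriv_nonneg (convex_Ico s t₀) (by fun_prop) ?_ ?_ <;> rw [interior_Ico]
    · exact fun r hr => (hd r hr).differentiableAt.differentiableWithinAt
    · intro r hr
      rw [(hd r hr).deriv]
      have hss : s ∈ Ico s t₀ := ⟨le_rfl, ht.1.trans_lt ht.2⟩
      linarith [hm r ⟨hr.1.le, hr.2⟩, hV s (hsub hss)]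
  have := hmono ⟨le_rfl, ht.1.trans_lt ht.2⟩ ht ht.1
  simp only [sub_self] at this
  linarith

theorem two_rpow_lt_one {p : ℝ} (hp : 1 < p) : (2 : ℝ) ^ (-((p - 1) / 2)) < 1 :=
  Real.rpow_lt_one_of_one_lt_of_neg one_lt_two (by linarith)

/-- Blow-up for `∂ₜ² U ≥ Λ U ^ p`, in integrated form: the length of the interval of existence is
controlled by the initial size. -/
theorem length_le_of_superlinear {p Λ y a b : ℝ} {U : ℝ → ℝ} (hp : 1 < p) (hΛ : 0 < Λ)
    (hy : 0 < y) (hU : ∀ t ∈ Ico a b, y ≤ U t)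
    (H : ∀ s m, a ≤ s → 0 ≤ m → (∀ r ∈ Ico s b, m ≤ Λ * U r ^ p) → ∀ t ∈ Ico s b,
      U s + m * (t - s) ^ 2 / 2 ≤ U t) :
    (b - a) * (1 - 2 ^ (-((p - 1) / 2))) ≤ √(2 / (Λ * y ^ (p - 1))) := by
  -- Ratio of successive doubling times: `2 ^ p * θ ^ 2 = 2` says that doubling `U` shortens the
  -- next doubling by `θ`.
  set θ : ℝ := 2 ^ (-((p - 1) / 2)) with hθ
  have hθ0 : 0 < θ := by positivity
  have hθ1 : θ < 1 := two_rpow_lt_one hp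
  have hθ1' : 0 < 1 - θ := by linarith
  -- The first doubling time: acceleration `Λ y ^ p` during `τ` adds exactly `y`.
  set τ : ℝ := √(2 / (Λ * y ^ (p - 1))) with hτ
  have hτ0 : 0 < τ := by positivity
  have hθ2 : (2 : ℝ) ^ p * θ ^ 2 = 2 := by
    rw [hθ, ← Real.rpow_natCast, ← Real.rpow_mul (by norm_num), ← Real.rpow_add (by norm_num),
      show p + -((p - 1) / 2) * ((2 : ℕ) : ℝ) = 1 by push_cast; ring, Real.rpow_one]
  have hτ2 : Λ * y ^ p * τ ^ 2 = 2 * y := by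
    rw [hτ, Real.sq_sqrt (by positivity), show y ^ p = y ^ (p - 1) * y by
      rw [← Real.rpow_add_one hy.ne']; ring_nf]
    field_simp
  by_contra! hlt
  have hlen : τ / (1 - θ) < b - a := (div_lt_iff₀ hθ1').2 hlt
  -- From `σ k` on, `U` is at least `2 ^ k * y`. The `σ k` stay below `a + τ / (1 - θ)`, where `U`
  -- would have to exceed every `2 ^ k * y`.
  set σ : ℕ → ℝ := fun k => a + τ * ((1 - θ ^ k) / (1 - θ)) with hσ
  have hσa : ∀ k, a ≤ σ k := fun k => by
    have : θ ^ k ≤ 1 := pow_le_one₀ hθ0.le hθ1.le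
    have : 0 ≤ τ * ((1 - θ ^ k) / (1 - θ)) :=
      mul_nonneg hτ0.le (div_nonneg (by linarith) hθ1'.le)
    simp only [hσ]
    linarith
  have hσt : ∀ k, σ k ≤ a + τ / (1 - θ) := fun k => by
    have : 0 ≤ θ ^ k := by positivity
    simp only [hσ]
    rw [mul_div_assoc']
    gcongr
    nlinarith
  have hσs : ∀ k, σ (k + 1) = σ k + τ * θ ^ k := fun k => by
    simp only [hσ, pow_succ]
    field_simp
    ring
  have key : ∀ k : ℕ, ∀ t ∈ Ico (σ k) b, 2 ^ k * y ≤ U t := by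
    intro k
    induction k with
    | zero =>
      intro t ht
      simpa using hU t ⟨by simpa [hσ] using ht.1, ht.2⟩
    | succ k ih =>
      intro t ht
      have hσk : 0 < τ * θ ^ k := by positivity
      have ht' : t ∈ Ico (σ k) b := ⟨by linarith [ht.1, hσs k], ht.2⟩
      have h1 := H (σ k) (Λ * (2 ^ k * y) ^ p) (hσa k) (by positivity) (fun r hr => by
        have := ih r hr
        gcongr) t ht'
      have h2 := ih (σ k) ⟨le_rfl, ht'.1.trans_lt ht'.2⟩
      have h3 : (τ * θ ^ k) ^ 2 ≤ (t - σ k) ^ 2 := by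
        gcongr
        linarith [ht.1, hσs k]
      have h4 : Λ * (2 ^ k * y) ^ p * (τ * θ ^ k) ^ 2 / 2 = 2 ^ k * y := by
        rw [Real.mul_rpow (by positivity) hy.le, ← Real.rpow_natCast_mul (by norm_num), mul_comm (k : ℝ),
          Real.rpow_mul_natCast (by norm_num)]
        calc Λ * (((2 : ℝ) ^ p) ^ k * y ^ p) * (τ * θ ^ k) ^ 2 / 2
            = (Λ * y ^ p * τ ^ 2) * ((2 : ℝ) ^ p * θ ^ 2) ^ k / 2 := by ring
          _ = 2 ^ k * y := by rw [hτ2, hθ2]; ring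
      have h5 : Λ * (2 ^ k * y) ^ p * (τ * θ ^ k) ^ 2 / 2
          ≤ Λ * (2 ^ k * y) ^ p * (t - σ k) ^ 2 / 2 := by gcongr
      rw [pow_succ]
      linarith
  obtain ⟨k, hk⟩ := pow_unbounded_of_one_lt (U (a + τ / (1 - θ)) / y) (one_lt_two (α := ℝ))
  have h1 := key k (a + τ / (1 - θ)) ⟨hσt k, by linarith⟩
  rw [div_lt_iff₀ hy] at hk
  linarith

theorem rpow_ge_of_mem_Icc {x T₀ β : ℝ} (hT₀ : 0 < T₀) (h1 : T₀ ≤ x) (h2 : x ≤ 5 * T₀) :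
    min 1 (5 ^ β) * T₀ ^ β ≤ x ^ β := by
  have h0 : 0 ≤ T₀ ^ β := by positivity
  rcases le_total 0 β with h | h
  · calc min 1 (5 ^ β) * T₀ ^ β ≤ 1 * T₀ ^ β := by gcongr; exact min_le_left _ _
      _ ≤ x ^ β := by rw [one_mul]; gcongr
  · calc min 1 (5 ^ β) * T₀ ^ β ≤ 5 ^ β * T₀ ^ β := by gcongr; exact min_le_right _ _
      _ = (5 * T₀) ^ β := (Real.mul_rpow (by norm_num) hT₀.le).symm
      _ ≤ x ^ β := Real.rpow_le_rpow_of_nonpos (by linarith) h2 h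

/-- A quantitative form of the lemma of Kato. -/
theorem exists_kato_constant {p β ν R c₁ c₂ : ℝ} (hp : 1 < p) (hν : 0 ≤ ν) (hR : 0 ≤ R)
    (hc₁ : 0 < c₁) (hc₂ : 0 < c₂) :
    ∃ K : ℝ, 0 < K ∧ ∀ (A T T₀ : ℝ) (U V : ℝ → ℝ), 0 < A → 1 ≤ T₀ → 4 * T₀ ≤ T →
      (∀ t ∈ Ico 0 T, HasDerivWithinAt U (V t) (Ico 0 T) t) → (∀ t ∈ Ico 0 T, 0 ≤ V t) →
      (∀ t ∈ Ico 0 T, 0 ≤ U t) →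
      (∀ s t₀ m, 1 ≤ s → t₀ ≤ T → 0 ≤ m →
        (∀ r ∈ Ico s t₀, m ≤ c₁ * A * (1 + r) ^ β ∨ m ≤ c₂ * (r + R) ^ (-ν) * U r ^ p) →
        ∀ t ∈ Ico s t₀, m * (t - s) ≤ V t - V s) →
      A ^ (p - 1) * T₀ ^ ((β + 2) * (p - 1) - ν + 2) ≤ K := by
  set κ : ℝ := min 1 (5 ^ β) with hκ
  have hκ0 : 0 < κ := lt_min one_pos (by positivity)
  set θ : ℝ := 2 ^ (-((p - 1) / 2)) with hθ
  have hθ1 : 0 < 1 - θ := by linarith [two_rpow_lt_one hp]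
  set K₀ : ℝ := c₂ * (4 + R) ^ (-ν) * (c₁ * κ / 2) ^ (p - 1) with hK₀
  have hK₀0 : 0 < K₀ := by positivity
  refine ⟨1 / (2 * (1 - θ) ^ 2 * K₀), by positivity, ?_⟩
  intro A T T₀ U V hA hT₀ hT hUd hV hU hinc
  have hT₀0 : 0 < T₀ := by linarith
  have hquad : ∀ s t₀ m, 1 ≤ s → t₀ ≤ T → 0 ≤ m →
      (∀ r ∈ Ico s t₀, m ≤ c₁ * A * (1 + r) ^ β ∨ m ≤ c₂ * (r + R) ^ (-ν) * U r ^ p) →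
      ∀ t ∈ Ico s t₀, U s + m * (t - s) ^ 2 / 2 ≤ U t := fun s t₀ m hs ht₀ hm h t ht =>
    add_sq_le_of_increment (by linarith) ht₀ hUd hV (hinc s t₀ m hs ht₀ hm h) ht
  -- The size gained on `[T₀, 2 T₀]` from the first lower bound; there, and up to `4 T₀`, `1 + r`
  -- lies between `T₀` and `5 T₀`, so `(1 + r) ^ β` is at least `κ T₀ ^ β`.
  set y : ℝ := c₁ * A * (κ * T₀ ^ β) * T₀ ^ 2 / 2 with hy
  have hy0 : 0 < y := by positivity
  have hstart : y ≤ U (2 * T₀) := by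
    have := hquad T₀ (4 * T₀) (c₁ * A * (κ * T₀ ^ β)) hT₀ hT (by positivity) (fun r hr =>
      Or.inl (mul_le_mul_of_nonneg_left
        (rpow_ge_of_mem_Icc hT₀0 (by linarith [hr.1]) (by linarith [hr.2])) (by positivity)))
      (2 * T₀) ⟨by linarith, by linarith⟩
    have h0 := hU T₀ ⟨hT₀0.le, by linarith⟩
    rw [show 2 * T₀ - T₀ = T₀ by ring] at this
    linarith
  have hlow : ∀ t ∈ Ico (2 * T₀) (4 * T₀), y ≤ U t := by
    intro t ht
    have := hquad (2 * T₀) (4 * T₀) 0 (by linarith) hT le_rfl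
      (fun r hr => Or.inl (by have : 0 < 1 + r := by linarith [hr.1]
                              positivity)) t ht
    linarith
  -- On `[2 T₀, 4 T₀)` one has `r + R ≤ (4 + R) T₀`, so the second lower bound has a constant
  -- coefficient. Superlinear blow-up then limits the length `2 T₀`.
  set Λ : ℝ := c₂ * ((4 + R) * T₀) ^ (-ν) with hΛ
  have hΛ0 : 0 < Λ := by positivity
  have hlen := length_le_of_superlinear hp hΛ0 hy0 hlow (fun s m hs hm h t ht =>
    hquad s (4 * T₀) m (by linarith) hT hm (fun r hr => Or.inr ((h r hr).trans (by
      have hr2 : r < 4 * T₀ := hr.2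
      have hr1 : 2 * T₀ ≤ r := hs.trans hr.1
      have hUr : 0 ≤ U r := hU r ⟨by linarith, by linarith⟩
      have h1 : ((4 + R) * T₀) ^ (-ν) ≤ (r + R) ^ (-ν) :=
        Real.rpow_le_rpow_of_nonpos (by linarith) (by nlinarith) (by linarith)
      rw [hΛ]
      gcongr))) t ht)
  rw [← hθ, show 4 * T₀ - 2 * T₀ = 2 * T₀ by ring] at hlen
  have hsq : (2 * T₀ * (1 - θ)) ^ 2 ≤ 2 / (Λ * y ^ (p - 1)) := by
    calc (2 * T₀ * (1 - θ)) ^ 2 ≤ √(2 / (Λ * y ^ (p - 1))) ^ 2 := by gcongr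
      _ = _ := Real.sq_sqrt (by positivity)
  rw [le_div_iff₀ (by positivity)] at hsq
  have hΛy : Λ * y ^ (p - 1) * T₀ ^ 2
      = K₀ * (A ^ (p - 1) * T₀ ^ ((β + 2) * (p - 1) - ν + 2)) := by
    have e1 : y = c₁ * κ / 2 * (A * T₀ ^ (β + 2)) := by
      rw [hy, Real.rpow_add hT₀0, Real.rpow_two]
      ring
    have e2 : T₀ ^ ((β + 2) * (p - 1) - ν + 2)
        = T₀ ^ ((β + 2) * (p - 1)) * T₀ ^ (-ν) * T₀ ^ 2 := by
      rw [← Real.rpow_two, ← Real.rpow_add hT₀0, ← Real.rpow_add hT₀0]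
      ring_nf
    rw [e1, e2, hΛ, hK₀, Real.mul_rpow (by positivity) hT₀0.le,
      Real.mul_rpow (by positivity) (by positivity), Real.mul_rpow hA.le (by positivity),
      ← Real.rpow_mul hT₀0.le]
    ring
  rw [le_div_iff₀ (by positivity)]
  nlinarith [hsq, hΛy]

end Blowup

/-! ### The lifespan estimate -/

section Lifespan

variable {n : ℕ}

local notation "𝔼" => EuclideanSpace ℝ (Fin n)

/-- Completing the square, `4 (n - 1) γ = D - (2 (n - 1) p - (n + 1))²` with `D` the discriminant.
The base of the square is below `√D` by the bound on `p`, and above `n - 3 ≥ -1 ≥ -√D` because `p >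
1`. -/
theorem gammaExponent_pos (hn : 2 ≤ n) {p : ℝ} (hp₁ : 1 < p) (hp₂ : p < straussExponent n) :
    0 < gammaExponent p n := by
  have hn' : (2 : ℝ) ≤ n := by exact_mod_cast hn
  rw [straussExponent, lt_div_iff₀ (by linarith)] at hp₂
  set D : ℝ := (n : ℝ) ^ 2 + 10 * (n : ℝ) - 7 with hD
  have hD17 : 17 ≤ D := by rw [hD]; nlinarith
  have hs : √D ^ 2 = D := Real.sq_sqrt (by linarith)
  have hs1 : 1 ≤ √D := Real.one_le_sqrt.2 (by linarith)
  have h1 : 2 * ((n : ℝ) - 1) < p * (2 * ((n : ℝ) - 1)) := by nlinarith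
  have h2 : (p * (2 * ((n : ℝ) - 1)) - (n + 1)) ^ 2 < √D ^ 2 :=
    sq_lt_sq' (by linarith) (by linarith)
  have h3 : 4 * ((n : ℝ) - 1) * gammaExponent p n
      = D - (p * (2 * ((n : ℝ) - 1)) - (n + 1)) ^ 2 := by
    rw [gammaExponent, hD]
    ring
  have h4 : 0 < 4 * ((n : ℝ) - 1) * gammaExponent p n := by linarith
  exact pos_of_mul_pos_right h4 (by linarith)

variable {p R ε T : ℝ} {f g : EuclideanSpace ℝ (Fin n) → ℝ}
  {u ut : ℝ → EuclideanSpace ℝ (Fin n) → ℝ}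

theorem IsSolution.mono_radius (sol : IsSolution p f g R ε T u ut) {R' : ℝ} (h : R ≤ R') :
    IsSolution p f g R' ε T u ut :=
  { sol with
    support_u := fun t ht => (sol.support_u t ht).mono fun x hx h' => hx (by linarith)
    support_ut := fun t ht => (sol.support_ut t ht).mono fun x hx h' => hx (by linarith) }

theorem planeMomentum_zero (r : ℝ) (u ut : ℝ → 𝔼 → ℝ) (t : ℝ) :
    planeMomentum r 0 u ut t = expMean r 0 (ut t) := by
  simp [planeMomentum]

theorem exists_lifespan_constant (hn : 2 ≤ n) (hp : 1 < p) (hR : 1 ≤ R)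
    (hg : MemLp g 2) (hf_nonneg : ∀ᵐ x, 0 ≤ f x) (hg_nonneg : ∀ᵐ x, 0 ≤ g x)
    (hg_pos : 0 < ∫ x, g x * Real.exp (-‖x‖)) :
    ∃ K : ℝ, 0 < K ∧ ∀ (ε T T₀ : ℝ) (u ut : ℝ → 𝔼 → ℝ), 0 < ε → 1 ≤ T₀ → 4 * T₀ ≤ T →
      IsSolution p f g R ε T u ut →
      ε ^ (p * (p - 1)) * T₀ ^ (gammaExponent p n / 2) ≤ K := by
  have hp0 : 0 < p := by linarith
  obtain ⟨c₁, hc₁, h₁⟩ := exists_integral_rpow_ge_data hn hp hR hg hg_nonneg hg_pos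
  obtain ⟨c₂, hc₂, h₂⟩ := exists_integral_rpow_ge_mean (n := n) (p := p) (by omega) hp hR
  obtain ⟨K, hK, hkato⟩ := exists_kato_constant (β := ((n : ℝ) - 1) * (1 - p / 2))
    (ν := n * (p - 1)) hp (mul_nonneg n.cast_nonneg (by linarith)) (by linarith : 0 ≤ R) hc₁ hc₂
  refine ⟨K, hK, fun ε T T₀ u ut hε hT₀ hT sol => ?_⟩
  have hTpos : 0 < T := by linarith
  set U := fun t => expMean (T + R) 0 (u t) with hU
  set V := fun t => expMean (T + R) 0 (ut t) with hV
  have hUd : ∀ t ∈ Ico 0 T, HasDerivWithinAt U (V t) (Ico 0 T) t := fun t ht =>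
    sol.hasDerivWithinAt_expMean (T + R) 0 ht
  have hV0 : ∀ t ∈ Ico 0 T, 0 ≤ V t := by
    intro t ht
    have := sol.planeMomentum_ge hp0 hε hg hf_nonneg hg_nonneg (ξ := 0) (by simp) ht
    rw [planeMomentum_zero] at this
    exact (mul_pos hε hg_pos).le.trans this
  have hUmono : MonotoneOn U (Ico 0 T) := by
    refine monotoneOn_of_hasDerivWithinAt_nonneg (f' := V) (convex_Ico 0 T)
      (fun t ht => (hUd t ht).continuousWithinAt) ?_ ?_ <;> rw [interior_Ico]
    · exact fun t ht => (hUd t ⟨ht.1.le, ht.2⟩).mono Ioo_subset_Ico_self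
    · exact fun t ht => hV0 t ⟨ht.1.le, ht.2⟩
  have hU0 : ∀ t ∈ Ico 0 T, 0 ≤ U t := fun t ht =>
    (sol.expMean_zero_nonneg hε hf_nonneg (T + R) 0).trans
      (hUmono ⟨le_rfl, hTpos⟩ ht ht.1)
  -- With `β = (n - 1) (1 - p / 2)` and `ν = n (p - 1)`, the exponent `(β + 2) (p - 1) - ν + 2`
  -- equals `γ / 2`.
  have key := hkato (ε ^ p) T T₀ U V (by positivity) hT₀ hT hUd hV0 hU0 ?_
  · rw [← Real.rpow_mul hε.le] at key
    refine le_of_eq_of_le ?_ key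
    rw [gammaExponent]
    ring_nf
  · intro s t₀ m hs ht₀ hm h t ht
    have := sol.planeMomentum_increment hp0 0 (m := m) (by linarith) ht.1 ht.2 ht₀ hm
      (fun r hr hint => ?_)
    · simpa only [planeMomentum_zero] using this
    · simp only [norm_zero, zero_mul, neg_zero, Real.exp_zero, one_mul]
      have hr1 : 1 ≤ r := hs.trans hr.1
      have hrT : r < T := hr.2.trans_le ht₀
      rcases h r hr with h' | h'
      · exact h'.trans (h₁ f ε T u ut hf_nonneg hε sol r hr1 hrT hint)
      · exact h'.trans (h₂ f g ε T u ut sol r (by linarith) hrT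
          (hU0 r ⟨by linarith, hrT⟩) hint)

end Lifespan

end SemilinearWave

theorem theorem3p1 (n : ℕ) (hn : 2 ≤ n) (p : ℝ) (hp₁ : 1 < p)
    (hp₂ : p < SemilinearWave.straussExponent n)
    (f g : EuclideanSpace ℝ (Fin n) → ℝ)
    (hf : SemilinearWave.MemH1 f) (hg : MemLp g 2)
    (hf_nonneg : ∀ᵐ x, 0 ≤ f x) (hg_nonneg : ∀ᵐ x, 0 ≤ g x)
    (hf_supp : ∃ K : Set (EuclideanSpace ℝ (Fin n)), IsCompact K ∧ ∀ᵐ x, x ∉ K → f x = 0)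
    (hg_supp : ∃ K : Set (EuclideanSpace ℝ (Fin n)), IsCompact K ∧ ∀ᵐ x, x ∉ K → g x = 0)
    (hg_ne : ¬ ∀ᵐ x, g x = 0) (R : ℝ) :
    ∃ ε₀ : ℝ, 0 < ε₀ ∧ ∃ C : ℝ, 0 < C ∧ ∀ ε : ℝ, 0 < ε → ε ≤ ε₀ →
      SemilinearWave.lifespan p f g R ε ≤
        ENNReal.ofReal (C * ε ^ (-(2 * p * (p - 1) / SemilinearWave.gammaExponent p n))) := by
  open SemilinearWave in
  have hγ : 0 < gammaExponent p n := gammaExponent_pos hn hp₁ hp₂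
  have hg_pos := integral_mul_exp_neg_norm_pos hg hg_nonneg hg_supp hg_ne
  obtain ⟨K, hK, hlife⟩ := exists_lifespan_constant hn hp₁ (le_max_right R 1) hg hf_nonneg
    hg_nonneg hg_pos
  set γ := gammaExponent p n with hγdef
  -- Makes `M ^ (γ / 2) ≥ 2 K`, which contradicts the bound by `K` when `T₀ = M ε ^ (-κ)`.
  set M : ℝ := max 1 ((2 * K) ^ (2 / γ)) with hM
  have hM1 : 1 ≤ M := le_max_left _ _
  have hM0 : 0 < M := by linarith
  -- `ε ≤ 1` ensures `T₀ ≥ 1`, and the factor 4 comes from the requirement `4 T₀ ≤ T`.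
  refine ⟨1, one_pos, 4 * M, by positivity, fun ε hε hε1 => ?_⟩
  refine iSup₂_le fun T hT => ENNReal.ofReal_le_ofReal ?_
  obtain ⟨hT0, u, ut, sol⟩ := hT
  by_contra! hlt
  set κ := 2 * p * (p - 1) / γ with hκ
  have hκ0 : 0 ≤ κ := div_nonneg (mul_nonneg (by linarith) (by linarith)) hγ.le
  have hεκ : 1 ≤ ε ^ (-κ) := Real.one_le_rpow_of_pos_of_le_one_of_nonpos hε hε1 (by linarith)
  have h := hlife ε T (M * ε ^ (-κ)) u ut hε (one_le_mul_of_one_le_of_one_le hM1 hεκ)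
    (by linarith) (sol.mono_radius (le_max_left R 1))
  have h1 : ε ^ (p * (p - 1)) * (M * ε ^ (-κ)) ^ (γ / 2) = M ^ (γ / 2) := by
    rw [Real.mul_rpow hM0.le (by positivity), ← Real.rpow_mul hε.le, mul_left_comm,
      ← Real.rpow_add hε, show p * (p - 1) + -κ * (γ / 2) = 0 by rw [hκ]; field_simp; ring,
      Real.rpow_zero, mul_one]
  have h2 : 2 * K ≤ M ^ (γ / 2) := by
    calc 2 * K = ((2 * K) ^ (2 / γ)) ^ (γ / 2) := by
          rw [← Real.rpow_mul (by positivity), show 2 / γ * (γ / 2) = 1 by field_simp,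
            Real.rpow_one]
      _ ≤ M ^ (γ / 2) := by
          have : (2 * K) ^ (2 / γ) ≤ M := le_max_right _ _
          gcongr
  rw [h1] at h
  linarith
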